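/- Let \(0<\alpha<1\) and \(p>0\). Let \(\{a_{ij}\}_{i\le j,\ i,j\in\mathbb N}\) be i.i.d. real random variables with finite moments \(X_k=\mathbf E\,a_{ij}^k\) of all orders, and put \(a_{ji}=a_{ij}\). For every \(N\ge p\) let \(\{d^{(N)}_{ij}\}_{1\le i\le j\le N}\) be independent random variables, independent of \(\{a_{ij}\}\), with \(d^{(N)}_{ij}=1\) with probability \(p/N\) and \(d^{(N)}_{ij}=0\) with probability \(1-p/N\), and put \(d^{(N)}_{ji}=d^{(N)}_{ij}\). Let \(I_{\alpha,N}=\{1,\dots,\lfloor\alpha N\rfloor\}\) and let \(A^{(N)}\) be the real symmetric \(N\times N\) matrix with entries \(A^{(N)}_{ij}=a_{ij}d^{(N)}_{ij}\) if exactly one of \(i,j\) lies in \(I_{\alpha,N}\), and \(A^{(N)}_{ij}=0\) otherwise. Let \(\sigma_N=\frac1N\sum_{j=1}^N\delta_{\lambda_j}\) be the normalized counting measure of the eigenvalues \(\lambda_1,\dots,\lambda_N\) of \(A^{(N)}\), let \(\mathcal M^{(N)}_k=\int\lambda^k\,d\sigma_N(\lambda)\), \(M^{(N)}_k=\mathbf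 E\,\mathcal M^{(N)}_k\), and \(C^{(N)}_{k,m}=\mathbf E\{\mathcal M^{(N)}_k\mathcal M^{(N)}_m\}-\mathbf E\{\mathcal M^{(N)}_k\}\,\mathbf E\{\mathcal M^{(N)}_m\}\). Let the numbers \(S^{(1)}(l,r),S^{(2)}(l,r)\), \(0\le r\le l\), be determined by \(S^{(1)}(l,0)=\alpha\,\delta_{l,0}\), \(S^{(2)}(l,0)=(1-\alpha)\,\delta_{l,0}\) and, for \(1\le r\le l\), \[ S^{(1)}(l,r)=p\sum_{f=1}^{r}\binom{r-1}{f-1}X_{2f}\sum_{u=0}^{l-r}S^{(1)}(l-u-f,r-f)\sum_{v=0}^{u}\binom{f+v-1}{f-1}S^{(2)}(u,v), \] \[ S^{(2)}(l,r)=p\sum_{f=1}^{r}\binom{r-1}{f-1}X_{2f}\sum_{u=0}^{l-r}S^{(2)}(l-u-f,r-f)\sum_{v=0}^{u}\binom{f+v-1}{f-1}S^{(1)}(u,v), \] and put \(m_k=\sum_{i=0}^{k}\bigl(S^{(1)}(k,i)+S^{(2)}(k,i)\bigr)\). Assume that there is a constant \(C\) with \(X_{2m}\le (C m)^{2m}\)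 for all \(m\ge1\). Then all the expectations above are finite, and: (i) For all \(k,m\) there is a constant \(C(k,m,p,\alpha)\), which does not depend on \(N\) (but may depend on the law of the weights \(a_{ij}\)), such that \(|C^{(N)}_{k,m}|\le C(k,m,p,\alpha)/N\) for all \(N\ge p\). (ii) For every \(k\ge0\), \(\lim_{N\to\infty}M^{(N)}_{2k}=m_k\) and \(\lim_{N\to\infty}M^{(N)}_{2k+1}=0\). (iii) The limiting moments are nonnegative and satisfy Carleman's condition \(\sum_{k=1}^{\infty}m_k^{-1/(2k)}=\infty\), where \(0^{-1/(2k)}=\infty\). -/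

import Mathlib

open MeasureTheory ProbabilityTheory Filter Topology

noncomputable section

namespace BipartiteSpectrum

/-! ### The recurrence -/

/-- The two mutually recursive families, `S true` for the first one and `S false` for the second,
built from the parameters `p`, `α` and the sequence `X`.  The index `f` runs over `1, …, r`
(here `f = f' + 1` and `r = r' + 1`) and `u` over `0, …, l - r`; the latter range is empty
if `l < r`. -/
def S (p α : ℝ) (X : ℕ → ℝ) : Bool → ℕ → ℕ → ℝ
  | b, l, 0 => if l = 0 then (if b then α else 1 - α) else 0
  | b, l, r + 1 =>
      p * ∑ f : Fin (r + 1), (r.choose f : ℝ) * X (2 * (f + 1)) *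
        ∑ u : Fin (l - r), S p α X b (l - u - (f + 1)) (r - f) *
          ∑ v : Fin (u + 1), (((f : ℕ) + (v : ℕ)).choose f : ℝ) * S p α X (!b) u v
termination_by _ l _ => l
decreasing_by
  · have := u.isLt
    omega
  · have := u.isLt
    omega

/-- `S⁽¹⁾(l, r)`. -/
def S₁ (p α : ℝ) (X : ℕ → ℝ) (l r : ℕ) : ℝ := S p α X true l r

/-- `S⁽²⁾(l, r)`. -/
def S₂ (p α : ℝ) (X : ℕ → ℝ) (l r : ℕ) : ℝ := S p α X false l r

theorem S₁_zero (p α : ℝ) (X : ℕ → ℝ) (l : ℕ) : S₁ p α X l 0 = α * (if l = 0 then 1 else 0) := by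
  simp [S₁, S]

theorem S₂_zero (p α : ℝ) (X : ℕ → ℝ) (l : ℕ) :
    S₂ p α X l 0 = (1 - α) * (if l = 0 then 1 else 0) := by
  simp [S₂, S]

theorem S_rec (p α : ℝ) (X : ℕ → ℝ) (b : Bool) (l r : ℕ) (hr : 1 ≤ r) (hl : r ≤ l) :
    S p α X b l r = p * ∑ f ∈ Finset.Icc 1 r, ((r - 1).choose (f - 1) : ℝ) * X (2 * f) *
      ∑ u ∈ Finset.Icc 0 (l - r), S p α X b (l - u - f) (r - f) *
        ∑ v ∈ Finset.Icc 0 u, ((f + v - 1).choose (f - 1) : ℝ) * S p α X (!b) u v := by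
  obtain ⟨r, rfl⟩ : ∃ s, r = s + 1 := ⟨r - 1, by omega⟩
  have hI : ∀ n : ℕ, Finset.Icc 0 n = Finset.range (n + 1) := fun n => by ext; simp
  have h1 : Finset.Icc 1 (r + 1) = (Finset.range (r + 1)).map (addRightEmbedding 1) := by
    ext x
    simp only [Finset.mem_Icc, Finset.mem_map, Finset.mem_range, addRightEmbedding_apply]
    constructor
    · intro h
      exact ⟨x - 1, by omega, by omega⟩
    · rintro ⟨y, h, rfl⟩
      omega
  have h2 : l - (r + 1) + 1 = l - r := by omega
  rw [S, h1, Finset.sum_map]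
  simp only [hI, h2, addRightEmbedding_apply, Finset.sum_range, Nat.add_sub_cancel,
    Nat.add_sub_add_right]
  congr 1
  refine Finset.sum_congr rfl fun f _ => ?_
  congr 1
  refine Finset.sum_congr rfl fun u _ => ?_
  congr 1
  refine Finset.sum_congr rfl fun v _ => ?_
  rw [show (f : ℕ) + 1 + v - 1 = f + v by omega]

theorem S₁_rec (p α : ℝ) (X : ℕ → ℝ) (l r : ℕ) (hr : 1 ≤ r) (hl : r ≤ l) :
    S₁ p α X l r = p * ∑ f ∈ Finset.Icc 1 r, ((r - 1).choose (f - 1) : ℝ) * X (2 * f) *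
      ∑ u ∈ Finset.Icc 0 (l - r), S₁ p α X (l - u - f) (r - f) *
        ∑ v ∈ Finset.Icc 0 u, ((f + v - 1).choose (f - 1) : ℝ) * S₂ p α X u v :=
  S_rec p α X true l r hr hl

theorem S₂_rec (p α : ℝ) (X : ℕ → ℝ) (l r : ℕ) (hr : 1 ≤ r) (hl : r ≤ l) :
    S₂ p α X l r = p * ∑ f ∈ Finset.Icc 1 r, ((r - 1).choose (f - 1) : ℝ) * X (2 * f) *
      ∑ u ∈ Finset.Icc 0 (l - r), S₂ p α X (l - u - f) (r - f) *
        ∑ v ∈ Finset.Icc 0 u, ((f + v - 1).choose (f - 1) : ℝ) * S₁ p α X u v :=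
  S_rec p α X false l r hr hl

/-- The numbers `m_k = ∑_{i=0}^k (S⁽¹⁾(k,i) + S⁽²⁾(k,i))`. -/
def limitMoment (p α : ℝ) (X : ℕ → ℝ) (k : ℕ) : ℝ :=
  ∑ i ∈ Finset.range (k + 1), (S₁ p α X k i + S₂ p α X k i)

/-! ### The random matrix ensemble -/

/-- `X_k`, the `k`-th moment of the probability law `ρ` of the weights. -/
def weightMoment (ρ : Measure ℝ) (k : ℕ) : ℝ := ∫ x, x ^ k ∂ρ

/-- The random weights `a` and the random edge indicators `d N` of the ensemble.  Symmetric families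
`a_{ij} = a_{ji}` are indexed by unordered pairs `s(i, j)` (with `i = j` allowed).  The weights are
i.i.d. with law `ρ`; for each `N ≥ p` the indicators `d N` are independent, equal to `1` with
probability `p / N` and to `0` with probability `1 - p / N`, and independent of the weights. -/
structure IsEnsemble {Ω : Type*} [MeasurableSpace Ω] (P : Measure Ω) (ρ : Measure ℝ) (p : ℝ) (a : Sym2 ℕ → Ω → ℝ)
    (d : (N : ℕ) → Sym2 (Fin N) → Ω → ℝ) : Prop where
  measurable_a : ∀ e, Measurable (a e)
  law_a : ∀ e, P.map (a e) = ρ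
  measurable_d : ∀ N : ℕ, p ≤ N → ∀ e, Measurable (d N e)
  prob_one : ∀ N : ℕ, p ≤ N → ∀ e, P {ω | d N e ω = 1} = ENNReal.ofReal (p / N)
  prob_zero : ∀ N : ℕ, p ≤ N → ∀ e, P {ω | d N e ω = 0} = ENNReal.ofReal (1 - p / N)
  /-- All the variables `a e` and `d N e'` together are jointly independent. -/
  indep : ∀ N : ℕ, p ≤ N →
    iIndepFun (Sum.elim a (d N) : Sym2 ℕ ⊕ Sym2 (Fin N) → Ω → ℝ) P

/-- The vertex `i` lies in the first part `I_{α,N}`, made of the first `⌊α N⌋` of the `N`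
vertices (which are numbered from `0`). -/
def InFirstPart (α : ℝ) (N : ℕ) (i : Fin N) : Prop := (i : ℕ) < ⌊α * N⌋₊

open Classical in
/-- The weighted adjacency matrix of the random bipartite graph. -/
def adj {Ω : Type*} (α : ℝ) (a : Sym2 ℕ → Ω → ℝ) (d : (N : ℕ) → Sym2 (Fin N) → Ω → ℝ) (N : ℕ)
    (ω : Ω) : Matrix (Fin N) (Fin N) ℝ :=
  Matrix.of fun i j =>
    if (InFirstPart α N i ∧ ¬ InFirstPart α N j) ∨ (¬ InFirstPart α N i ∧ InFirstPart α N j)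
    then a s((i : ℕ), (j : ℕ)) ω * d N s(i, j) ω else 0

theorem adj_isHermitian {Ω : Type*} (α : ℝ) (a : Sym2 ℕ → Ω → ℝ) (d : (N : ℕ) → Sym2 (Fin N) → Ω → ℝ) (N : ℕ)
    (ω : Ω) : (adj α a d N ω).IsHermitian := by
  refine Matrix.IsHermitian.ext fun i j => ?_
  have h1 : (s((j : ℕ), (i : ℕ)) : Sym2 ℕ) = s((i : ℕ), (j : ℕ)) := Sym2.eq_swap
  have h2 : (s(j, i) : Sym2 (Fin N)) = s(i, j) := Sym2.eq_swap
  simp only [adj, Matrix.of_apply, h1, h2, star_trivial]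
  congr 1
  apply propext
  tauto

/-- The normalized eigenvalue counting measure: mass `1 / N` at each of the `N` eigenvalues,
with multiplicity. -/
def spectralMeasure {Ω : Type*} (α : ℝ) (a : Sym2 ℕ → Ω → ℝ) (d : (N : ℕ) → Sym2 (Fin N) → Ω → ℝ) (N : ℕ)
    (ω : Ω) : Measure ℝ :=
  (N : ENNReal)⁻¹ • ∑ j : Fin N, Measure.dirac ((adj_isHermitian α a d N ω).eigenvalues j)

/-- The `k`-th moment of the normalized eigenvalue counting measure, a random variable. -/
def spectralMoment {Ω : Type*} (α : ℝ) (a : Sym2 ℕ → Ω → ℝ) (d : (N : ℕ) → Sym2 (Fin N) → Ω → ℝ) (N k : ℕ)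
    (ω : Ω) : ℝ :=
  ∫ x, x ^ k ∂(spectralMeasure α a d N ω)

/-- The expected `k`-th moment. -/
def expectedMoment {Ω : Type*} [MeasurableSpace Ω] (P : Measure Ω) (α : ℝ) (a : Sym2 ℕ → Ω → ℝ)
    (d : (N : ℕ) → Sym2 (Fin N) → Ω → ℝ) (N k : ℕ) : ℝ :=
  ∫ ω, spectralMoment α a d N k ω ∂P

/-- The correlator (covariance) of the `k`-th and the `m`-th spectral moments. -/
def correlator {Ω : Type*} [MeasurableSpace Ω] (P : Measure Ω) (α : ℝ) (a : Sym2 ℕ → Ω → ℝ)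
    (d : (N : ℕ) → Sym2 (Fin N) → Ω → ℝ) (N k m : ℕ) : ℝ :=
  (∫ ω, spectralMoment α a d N k ω * spectralMoment α a d N m ω ∂P) -
    expectedMoment P α a d N k * expectedMoment P α a d N m

end BipartiteSpectrum

end

/-!
# Moments of the spectral measure of sparse weighted random bipartite graphs

The `k`-th spectral moment is `1 / N` times the sum over all closed walks of length `k` of the
product of the entries along the walk.  By independence, the expectation of such a product is
`∏ (p / N) X_{m_e}` over the edges `e` of the walk, where `m_e` is the number of passages through
`e` (`IsEnsemble.integral_edgeEval`).  So a walk with `E` edges has weight `O(N ^ (-E))`, and there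
are `O(N ^ V)` walks with `V` vertices.  A connected graph has `V ≤ E + 1`, with equality only for
trees: only walks on trees survive in the limit, and two walks can be correlated only if they share
an edge, which makes their union connected and costs a factor `1 / N`.

The products of entries are handled as polynomials with natural coefficients in commuting variables
indexed by the edges, and the expectation as the additive functional `expect` on these polynomials.
Since all coefficients are nonnegative, error terms may be estimated by enlarging the family of
walks (`Dom`).  The estimate `V ≤ E + 1` is used in the form of a step-by-step exploration,
`walk_le`: a step to a new vertex has `N` choices and costs a factor `1 / N`, while a step to a
visited vertex has boundedly many choices, and gains `1 / N` if it uses a new edge.  It yields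
the three bounds `walk_pair_hit_le` (two walks with a common edge), `cycle_le` (an excursion which
closes a cycle) and `pinned_le` (a walk through a prescribed neighbour of its root).

For the limit, the generating function `G` of the closed walks at `i` satisfies `G = 1 + E G` with
the generating function `E` of the excursions from `i` (`closedSeries_eq`).  Up to walks with
cycles, `E` is the sum over the neighbours `j` of `a_{ij}²` times the variable times the function
`G` of `j` in the graph without `i`.  The coefficients of `E ^ r` enumerate the walks with `r`
returns; expanding `E ^ r` by the first branch `j` (`coeff_sum_branchSeries_pow`), and powers of `G` as
negative binomial series, gives the recurrence of `S`, once the factors of the expansion are known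
to be asymptotically independent.  This is `abs_expect_excursion_sub_le`, an induction on the length
in which the estimate is uniform over the removed set of vertices.

Carleman's condition follows from `S(l, r) ≤ A ^ l (l!) ^ 2` (`S_le`), proved directly from the
recurrence: the binomial coefficients in it are absorbed by the multinomial coefficient
`l! / (f! u! w!)`.
-/

noncomputable section

namespace BipartiteSpectrum

/-! ### Growth of the recurrence and Carleman's condition -/

open Finset in
theorem S_succ (p α : ℝ) (X : ℕ → ℝ) (b : Bool) (l r : ℕ) :
    S p α X b l (r + 1) = p * ∑ f ∈ range (r + 1), (r.choose f : ℝ) * X (2 * (f + 1)) *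
      ∑ u ∈ range (l - r), S p α X b (l - u - (f + 1)) (r - f) *
        ∑ v ∈ range (u + 1), ((f + v).choose f : ℝ) * S p α X (!b) u v := by
  rw [S]
  simp only [Finset.sum_range]

theorem S_eq_zero_of_lt (p α : ℝ) (X : ℕ → ℝ) (b : Bool) (l r : ℕ) (h : l < r) :
    S p α X b l r = 0 := by
  obtain ⟨r, rfl⟩ : ∃ s, r = s + 1 := ⟨r - 1, by omega⟩
  rw [S_succ, show l - r = 0 by omega]
  simp

open Finset in
/-- The recurrence with the half-lengths `u` (at the child) and `w` (the rest of the walk) as a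
convolution. -/
theorem S_succ_antidiagonal (p α : ℝ) (X : ℕ → ℝ) (b : Bool) (l r : ℕ) (h : r + 1 ≤ l) :
    S p α X b l (r + 1) = p * ∑ f ∈ range (r + 1), (r.choose f : ℝ) * X (2 * (f + 1)) *
      ∑ x ∈ antidiagonal (l - (f + 1)), S p α X b x.2 (r - f) *
        ∑ v ∈ range (x.1 + 1), ((f + v).choose f : ℝ) * S p α X (!b) x.1 v := by
  rw [S_succ]
  congr 1
  refine sum_congr rfl fun f hf => ?_
  have hf' : f < r + 1 := mem_range.1 hf
  congr 1
  rw [Nat.sum_antidiagonal_eq_sum_range_succ_mk]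
  have hsub : range (l - r) ⊆ range (l - (f + 1)).succ := by
    intro x; simp only [mem_range]; omega
  rw [← sum_subset hsub]
  · refine sum_congr rfl fun u hu => ?_
    have hu' := mem_range.1 hu
    dsimp only
    rw [show l - u - (f + 1) = l - (f + 1) - u by omega]
  · intro u hu hu'
    simp only [mem_range] at hu hu'
    rw [S_eq_zero_of_lt _ _ _ _ _ _ (by omega), zero_mul]

open Finset in
theorem S_nonneg {p α : ℝ} {X : ℕ → ℝ} (hp : 0 ≤ p) (hα : 0 ≤ α) (hα' : α ≤ 1)
    (hX : ∀ k, 0 ≤ X (2 * k)) (b : Bool) (l r : ℕ) : 0 ≤ S p α X b l r := by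
  induction l using Nat.strong_induction_on generalizing b r with
  | _ l ih =>
    cases r with
    | zero =>
      rw [S]
      split_ifs <;> linarith
    | succ r =>
      rw [S_succ]
      refine mul_nonneg hp (sum_nonneg fun f _ => mul_nonneg (mul_nonneg (Nat.cast_nonneg _) (hX _))
        (sum_nonneg fun u hu => ?_))
      have := mem_range.1 hu
      exact mul_nonneg (ih _ (by omega) _ _) (sum_nonneg fun v _ =>
        mul_nonneg (Nat.cast_nonneg _) (ih _ (by omega) _ _))

theorem le_choose_of_pos_of_lt (l u : ℕ) (hu : 1 ≤ u) (hul : u < l) : l ≤ l.choose u := by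
  induction l generalizing u with
  | zero => omega
  | succ l ih =>
    obtain ⟨u, rfl⟩ : ∃ s, u = s + 1 := ⟨u - 1, by omega⟩
    rw [Nat.choose_succ_succ']
    have h1 : 1 ≤ l.choose u := Nat.choose_pos (by omega)
    rcases Nat.lt_or_ge (u + 1) l with h | h
    · have := ih (u + 1) (by omega) h
      omega
    · obtain rfl : l = u + 1 := by omega
      simp

open Finset in
theorem sum_inv_choose_le (l : ℕ) : ∑ u ∈ range l, ((l.choose u : ℝ))⁻¹ ≤ 2 := by
  cases l with
  | zero => simp
  | succ l =>
    rw [sum_range_succ']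
    have h : ∀ u ∈ range l, (((l + 1).choose (u + 1) : ℝ))⁻¹ ≤ ((l + 1 : ℕ) : ℝ)⁻¹ := by
      intro u hu
      have := mem_range.1 hu
      have h2 := le_choose_of_pos_of_lt (l + 1) (u + 1) (by omega) (by omega)
      gcongr
    have h3 := sum_le_sum h
    rw [sum_const, card_range, nsmul_eq_mul] at h3
    have h4 : (l : ℝ) * ((l + 1 : ℕ) : ℝ)⁻¹ ≤ 1 := by
      rw [← div_eq_mul_inv, div_le_one (by positivity)]
      push_cast; linarith
    simp only [Nat.choose_zero_right, Nat.cast_one, inv_one]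
    linarith

/-- Both binomial factors of the recurrence are absorbed by one multinomial coefficient each. -/
theorem choose_mul_factorial_bound (r f u w l : ℕ) (hl : f + 1 + u + w = l)
    (hr : r + 1 ≤ l - u) :
    (r.choose f : ℝ) * ((f + 1).factorial : ℝ) ^ 2 * ((w.factorial : ℝ) ^ 2 *
      (((f + 1 + u).choose (f + 1) : ℝ) * (u.factorial : ℝ) ^ 2)) ≤
      (l.factorial : ℝ) ^ 2 * (l.choose u : ℝ)⁻¹ := by
  have h1 : r.choose f ≤ (l - u).choose (f + 1) :=
    (Nat.choose_le_choose (c := f + 1) hr).trans' (by rw [Nat.choose_succ_succ]; omega)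
  have e1 : (l.choose u) * u.factorial * ((l - u).choose (f + 1) * (f + 1).factorial * w.factorial)
      = l.factorial := by
    have a1 := Nat.choose_mul_factorial_mul_factorial (n := l - u) (k := f + 1) (by omega)
    rw [show l - u - (f + 1) = w by omega] at a1
    rw [a1]
    exact Nat.choose_mul_factorial_mul_factorial (by omega)
  have e2 : (l.choose w) * w.factorial *
      ((f + 1 + u).choose (f + 1) * (f + 1).factorial * u.factorial) = l.factorial := by
    have a1 := Nat.choose_mul_factorial_mul_factorial (n := f + 1 + u) (k := f + 1) (by omega)
    rw [show f + 1 + u - (f + 1) = u by omega] at a1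
    rw [a1]
    have a2 := Nat.choose_mul_factorial_mul_factorial (n := l) (k := w) (by omega)
    rwa [show l - w = f + 1 + u by omega] at a2
  have hw : 1 ≤ l.choose w := Nat.choose_pos (by omega)
  have hu : 0 < l.choose u := Nat.choose_pos (by omega)
  rw [← div_eq_mul_inv, le_div_iff₀ (by exact_mod_cast hu)]
  have key : r.choose f * (f + 1).factorial ^ 2 * (w.factorial ^ 2 *
      ((f + 1 + u).choose (f + 1) * u.factorial ^ 2)) * l.choose u ≤ l.factorial ^ 2 := by
    calc _ = (l.choose u * u.factorial * (r.choose f * (f + 1).factorial * w.factorial)) *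
          (1 * w.factorial * ((f + 1 + u).choose (f + 1) * (f + 1).factorial * u.factorial)) := by
          ring
      _ ≤ (l.choose u * u.factorial *
            ((l - u).choose (f + 1) * (f + 1).factorial * w.factorial)) *
          (l.choose w * w.factorial *
            ((f + 1 + u).choose (f + 1) * (f + 1).factorial * u.factorial)) := by gcongr
      _ = _ := by rw [e1, e2, sq]
  exact_mod_cast key

open Finset in
/-- Growth of the numbers `S⁽ⁱ⁾(l, r)`: factorial squared, up to a geometric factor. -/
theorem S_le {p α K : ℝ} {X : ℕ → ℝ} (hp : 0 ≤ p) (hα : 0 ≤ α) (hα' : α ≤ 1)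
    (hX : ∀ k, 0 ≤ X (2 * k)) (hK : 0 ≤ K)
    (hXK : ∀ k, 1 ≤ k → X (2 * k) ≤ K ^ k * (k.factorial : ℝ) ^ 2) (b : Bool) (l r : ℕ) :
    S p α X b l r ≤ ((2 * p + 1) * K + 1) ^ l * (l.factorial : ℝ) ^ 2 := by
  set A : ℝ := (2 * p + 1) * K + 1 with hA
  have hA1 : 1 ≤ A := by
    have : 0 ≤ (2 * p + 1) * K := by positivity
    linarith
  have hA0 : 0 < A := by linarith
  induction l using Nat.strong_induction_on generalizing b r with
  | _ l ih =>
    cases r with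
    | zero =>
      rw [S]
      split_ifs with h hb
      · subst h; simpa using hα'
      · subst h; simpa using hα
      · positivity
    | succ r =>
      have hterm : ∀ f ∈ range (r + 1), (r.choose f : ℝ) * X (2 * (f + 1)) *
          ∑ u ∈ range (l - r), S p α X b (l - u - (f + 1)) (r - f) *
            ∑ v ∈ range (u + 1), ((f + v).choose f : ℝ) * S p α X (!b) u v ≤
          (A ^ l * (l.factorial : ℝ) ^ 2) * (2 * (K / A) ^ (f + 1)) := by
        intro f hf
        have hf' := mem_range.1 hf
        rw [mul_sum]
        have hu : ∀ u ∈ range (l - r), (r.choose f : ℝ) * X (2 * (f + 1)) *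
            (S p α X b (l - u - (f + 1)) (r - f) *
              ∑ v ∈ range (u + 1), ((f + v).choose f : ℝ) * S p α X (!b) u v) ≤
            (A ^ l * (l.factorial : ℝ) ^ 2) * (K / A) ^ (f + 1) * (l.choose u : ℝ)⁻¹ := by
          intro u hu
          have hu' := mem_range.1 hu
          obtain ⟨w, hw⟩ : ∃ w, f + 1 + u + w = l := ⟨l - u - (f + 1), by omega⟩
          rw [show l - u - (f + 1) = w by omega]
          have h1 : ∑ v ∈ range (u + 1), ((f + v).choose f : ℝ) * S p α X (!b) u v ≤
              ((f + 1 + u).choose (f + 1) : ℝ) * (A ^ u * (u.factorial : ℝ) ^ 2) := by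
            have h2 := Nat.sum_range_add_choose u f
            have h3 : (∑ v ∈ range (u + 1), ((f + v).choose f : ℝ)) =
                ((f + 1 + u).choose (f + 1) : ℝ) := by
              rw [show f + 1 + u = u + f + 1 by omega, ← h2]
              push_cast
              exact sum_congr rfl fun v _ => by rw [add_comm]
            rw [← h3, sum_mul]
            refine sum_le_sum fun v _ => ?_
            gcongr
            exact ih u (by omega) _ _
          have hS0 := S_nonneg hp hα hα' hX b w (r - f)
          have hs0 : 0 ≤ ∑ v ∈ range (u + 1), ((f + v).choose f : ℝ) * S p α X (!b) u v :=
            sum_nonneg fun v _ => mul_nonneg (Nat.cast_nonneg _) (S_nonneg hp hα hα' hX _ _ _)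
          have hSw := ih w (by omega) b (r - f)
          have hX' := hXK (f + 1) (by omega)
          have hXn := hX (f + 1)
          calc _ ≤ (r.choose f : ℝ) * (K ^ (f + 1) * ((f + 1).factorial : ℝ) ^ 2) *
                ((A ^ w * (w.factorial : ℝ) ^ 2) *
                  (((f + 1 + u).choose (f + 1) : ℝ) * (A ^ u * (u.factorial : ℝ) ^ 2))) := by
                gcongr
            _ = (K ^ (f + 1) * A ^ (u + w)) * ((r.choose f : ℝ) * ((f + 1).factorial : ℝ) ^ 2 *
                ((w.factorial : ℝ) ^ 2 *
                  (((f + 1 + u).choose (f + 1) : ℝ) * (u.factorial : ℝ) ^ 2))) := by ring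
            _ ≤ (K ^ (f + 1) * A ^ (u + w)) * ((l.factorial : ℝ) ^ 2 * (l.choose u : ℝ)⁻¹) := by
                exact mul_le_mul_of_nonneg_left
                  (choose_mul_factorial_bound r f u w l hw (by omega)) (by positivity)
            _ = _ := by
                rw [← hw, div_pow]
                field_simp
                ring
        refine (sum_le_sum hu).trans ?_
        rw [← mul_sum]
        have h5 : ∑ u ∈ range (l - r), ((l.choose u : ℝ))⁻¹ ≤ 2 :=
          (sum_le_sum_of_subset_of_nonneg (range_subset_range.2 (by omega))
            (fun _ _ _ => by positivity)).trans (sum_inv_choose_le l)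
        calc _ ≤ (A ^ l * (l.factorial : ℝ) ^ 2) * (K / A) ^ (f + 1) * 2 := by gcongr
          _ = _ := by ring
      rw [S_succ]
      refine (mul_le_mul_of_nonneg_left (sum_le_sum hterm) hp).trans ?_
      rw [← mul_sum, ← mul_sum]
      have hq0 : 0 ≤ K / A := by positivity
      have hKA : K < A := by nlinarith
      have hq1 : K / A < 1 := by rwa [div_lt_one hA0]
      have hgeo : ∑ f ∈ range (r + 1), (K / A) ^ (f + 1) ≤ (K / A) * (1 - K / A)⁻¹ := by
        simp only [pow_succ']
        rw [← mul_sum]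
        gcongr
        rw [← tsum_geometric_of_lt_one hq0 hq1]
        exact (summable_geometric_of_lt_one hq0 hq1).sum_le_tsum _ fun _ _ => by positivity
      have hq : p * (2 * ((K / A) * (1 - K / A)⁻¹)) ≤ 1 := by
        have h1 : (K / A) * (1 - K / A)⁻¹ = K / (A - K) := by
          have : A - K ≠ 0 := by linarith
          have : 1 - K / A ≠ 0 := by linarith
          field_simp
        rw [h1, ← mul_assoc, mul_div_assoc', div_le_one (by linarith)]
        nlinarith
      calc _ = (A ^ l * (l.factorial : ℝ) ^ 2) *
            (p * (2 * ∑ f ∈ range (r + 1), (K / A) ^ (f + 1))) := by ring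
        _ ≤ (A ^ l * (l.factorial : ℝ) ^ 2) * (p * (2 * ((K / A) * (1 - K / A)⁻¹))) := by gcongr
        _ ≤ (A ^ l * (l.factorial : ℝ) ^ 2) * 1 := by gcongr
        _ = _ := mul_one _

theorem limitMoment_nonneg {p α : ℝ} {X : ℕ → ℝ} (hp : 0 ≤ p) (hα : 0 ≤ α) (hα' : α ≤ 1)
    (hX : ∀ k, 0 ≤ X (2 * k)) (k : ℕ) : 0 ≤ limitMoment p α X k :=
  Finset.sum_nonneg fun _ _ => add_nonneg (S_nonneg hp hα hα' hX _ _ _)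
    (S_nonneg hp hα hα' hX _ _ _)

theorem limitMoment_le {p α K : ℝ} {X : ℕ → ℝ} (hp : 0 ≤ p) (hα : 0 ≤ α) (hα' : α ≤ 1)
    (hX : ∀ k, 0 ≤ X (2 * k)) (hK : 0 ≤ K)
    (hXK : ∀ k, 1 ≤ k → X (2 * k) ≤ K ^ k * (k.factorial : ℝ) ^ 2) (k : ℕ) (hk : 1 ≤ k) :
    limitMoment p α X k ≤ (2 * ((2 * p + 1) * K + 1) * k) ^ (2 * k) := by
  set A : ℝ := (2 * p + 1) * K + 1 with hA
  have hA1 : 1 ≤ A := by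
    have : 0 ≤ (2 * p + 1) * K := by positivity
    linarith
  have h1 : limitMoment p α X k ≤ (k + 1) * (2 * (A ^ k * (k.factorial : ℝ) ^ 2)) := by
    have := Finset.sum_le_card_nsmul (Finset.range (k + 1))
      (fun i => S₁ p α X k i + S₂ p α X k i) (2 * (A ^ k * (k.factorial : ℝ) ^ 2)) (fun i _ => by
        have a1 := S_le hp hα hα' hX hK hXK true k i
        have a2 := S_le hp hα hα' hX hK hXK false k i
        simp only [S₁, S₂]
        linarith)
    simpa [limitMoment, nsmul_eq_mul] using this
  have h2 : 2 * (k + 1) ≤ 4 ^ k := by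
    clear h1
    induction k, hk using Nat.le_induction with
    | base => norm_num
    | succ k hk ih => rw [pow_succ]; omega
  have h2' : 2 * ((k : ℝ) + 1) ≤ 4 ^ k := by exact_mod_cast h2
  have h3 : (k.factorial : ℝ) ≤ (k : ℝ) ^ k := by exact_mod_cast Nat.factorial_le_pow k
  have h4 : A ^ k ≤ A ^ (2 * k) := pow_le_pow_right₀ hA1 (by omega)
  calc limitMoment p α X k ≤ (2 * ((k : ℝ) + 1)) * (A ^ k * (k.factorial : ℝ) ^ 2) := by
        linarith
    _ ≤ 4 ^ k * (A ^ (2 * k) * ((k : ℝ) ^ k) ^ 2) := by gcongr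
    _ = _ := by
      rw [mul_pow, mul_pow, ← pow_mul, mul_comm k 2, pow_mul 2 2 k]
      norm_num
      ring

/-- `F ^ F ≤ e ^ F F!` turns the growth hypothesis on the moments into a factorial bound. -/
theorem moment_le_factorial {X : ℕ → ℝ} {C : ℝ}
    (hC : ∀ m : ℕ, 1 ≤ m → X (2 * m) ≤ (C * m) ^ (2 * m)) (m : ℕ) (hm : 1 ≤ m) :
    X (2 * m) ≤ (C ^ 2 * Real.exp 1 ^ 2) ^ m * (m.factorial : ℝ) ^ 2 := by
  refine (hC m hm).trans ?_
  have h := Real.pow_div_factorial_le_exp (m : ℝ) (by positivity) m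
  rw [div_le_iff₀ (by positivity)] at h
  have h2 : Real.exp (m : ℝ) = Real.exp 1 ^ m := by
    rw [← Real.exp_nat_mul, mul_one]
  rw [h2] at h
  calc (C * m) ^ (2 * m) = (C ^ 2) ^ m * ((m : ℝ) ^ m) ^ 2 := by
        rw [mul_pow]; ring
    _ ≤ (C ^ 2) ^ m * (Real.exp 1 ^ m * (m.factorial : ℝ)) ^ 2 := by gcongr
    _ = _ := by ring

/-- Carleman's condition for a sequence with `m k ≤ (B k) ^ (2 k)`. -/
theorem carleman_of_le {m : ℕ → ℝ} {B : ℝ} (hB : 0 < B)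
    (h : ∀ k, 1 ≤ k → m k ≤ (B * k) ^ (2 * k)) :
    ∑' k : ℕ, (ENNReal.ofReal (m (k + 1)) ^ (1 / (2 * ((k : ℝ) + 1))))⁻¹ = ⊤ := by
  have hle : ∀ k : ℕ, ENNReal.ofReal (B⁻¹ * (1 / ((k : ℝ) + 1))) ≤
      (ENNReal.ofReal (m (k + 1)) ^ (1 / (2 * ((k : ℝ) + 1))))⁻¹ := by
    intro k
    have hk : (0 : ℝ) < (k : ℝ) + 1 := by positivity
    rw [show B⁻¹ * (1 / ((k : ℝ) + 1)) = (B * ((k : ℝ) + 1))⁻¹ by field_simp,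
      ENNReal.ofReal_inv_of_pos (by positivity)]
    refine ENNReal.inv_le_inv.2 ?_
    have h1 := h (k + 1) (by omega)
    push_cast at h1
    calc ENNReal.ofReal (m (k + 1)) ^ (1 / (2 * ((k : ℝ) + 1)))
        ≤ ENNReal.ofReal ((B * ((k : ℝ) + 1)) ^ (2 * (k + 1))) ^ (1 / (2 * ((k : ℝ) + 1))) := by
          gcongr
      _ = ENNReal.ofReal (B * ((k : ℝ) + 1)) := by
          rw [ENNReal.ofReal_pow (by positivity), ← ENNReal.rpow_natCast, ← ENNReal.rpow_mul]
          rw [show (((2 * (k + 1) : ℕ) : ℝ)) * (1 / (2 * ((k : ℝ) + 1))) = 1 by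
            push_cast; field_simp]
          exact ENNReal.rpow_one _
  by_contra hne
  have hne' : ∑' k : ℕ, ENNReal.ofReal (B⁻¹ * (1 / ((k : ℝ) + 1))) ≠ ⊤ :=
    ne_top_of_le_ne_top hne (ENNReal.tsum_le_tsum hle)
  have hs := ENNReal.summable_toReal hne'
  have hs2 : Summable fun k : ℕ => B⁻¹ * (1 / ((k : ℝ) + 1)) := by
    refine hs.congr fun k => ?_
    exact ENNReal.toReal_ofReal (by positivity)
  have hs3 : Summable fun k : ℕ => 1 / ((k : ℝ) + 1) :=
    (summable_mul_left_iff (inv_ne_zero hB.ne')).1 hs2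
  refine Real.not_summable_one_div_natCast ?_
  rw [← summable_nat_add_iff 1]
  simpa using hs3

section Functional

/-! ### Domination in a commutative semiring -/

/-- `Dom a b` says that `b` is `a` plus something.  For polynomials and power series with natural
coefficients this is coefficientwise inequality. -/
def Dom {R : Type*} [CommSemiring R] (a b : R) : Prop := ∃ c, b = a + c

namespace Dom

variable {R : Type*} [CommSemiring R] {a b c d : R}

theorem refl (a : R) : Dom a a := ⟨0, (add_zero a).symm⟩

theorem zero_left (a : R) : Dom 0 a := ⟨a, (zero_add a).symm⟩

theorem trans (h₁ : Dom a b) (h₂ : Dom b c) : Dom a c := by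
  obtain ⟨x, rfl⟩ := h₁
  obtain ⟨y, rfl⟩ := h₂
  exact ⟨x + y, add_assoc _ _ _⟩

theorem add (h₁ : Dom a b) (h₂ : Dom c d) : Dom (a + c) (b + d) := by
  obtain ⟨x, rfl⟩ := h₁
  obtain ⟨y, rfl⟩ := h₂
  exact ⟨x + y, by ring⟩

theorem mul (h₁ : Dom a b) (h₂ : Dom c d) : Dom (a * c) (b * d) := by
  obtain ⟨x, rfl⟩ := h₁
  obtain ⟨y, rfl⟩ := h₂
  exact ⟨a * y + x * c + x * y, by ring⟩

theorem pow (h : Dom a b) (n : ℕ) : Dom (a ^ n) (b ^ n) := by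
  induction n with
  | zero => simpa using refl 1
  | succ n ih => simpa only [pow_succ] using ih.mul h

theorem sum {ι : Type*} {s : Finset ι} {f g : ι → R} (h : ∀ i ∈ s, Dom (f i) (g i)) :
    Dom (∑ i ∈ s, f i) (∑ i ∈ s, g i) := by
  classical
  induction s using Finset.induction_on with
  | empty => simpa using refl 0
  | insert i s hi ih =>
    rw [Finset.sum_insert hi, Finset.sum_insert hi]
    exact (h i (Finset.mem_insert_self _ _)).add
      (ih fun j hj => h j (Finset.mem_insert_of_mem hj))

theorem sum_subset {ι : Type*} {s t : Finset ι} (hst : s ⊆ t) (f : ι → R) :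
    Dom (∑ i ∈ s, f i) (∑ i ∈ t, f i) := by
  classical
  exact ⟨∑ i ∈ t \ s, f i, by rw [add_comm, Finset.sum_sdiff hst]⟩

theorem single_sum {ι : Type*} {s : Finset ι} {i : ι} (hi : i ∈ s) (f : ι → R) :
    Dom (f i) (∑ j ∈ s, f j) := by
  simpa using sum_subset (Finset.singleton_subset_iff.2 hi) f

theorem coeff {a b : PowerSeries R} (h : Dom a b) (n : ℕ) :
    Dom (PowerSeries.coeff n a) (PowerSeries.coeff n b) := by
  obtain ⟨x, rfl⟩ := h
  exact ⟨PowerSeries.coeff n x, map_add _ _ _⟩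

end Dom

/-! ### Linear functionals on polynomials, given by their values on monomials -/

variable {σ : Type*}

/-- The additive functional on polynomials with natural coefficients whose value on the monomial
with exponent vector `m` is `g m`. -/
def functional (g : (σ →₀ ℕ) → ℝ) : MvPolynomial σ ℕ →ₗ[ℕ] ℝ :=
  (MvPolynomial.basisMonomials σ ℕ).constr ℕ g

theorem functional_monomial_one (g : (σ →₀ ℕ) → ℝ) (m : σ →₀ ℕ) :
    functional g (MvPolynomial.monomial m 1) = g m := by
  have := (MvPolynomial.basisMonomials σ ℕ).constr_basis ℕ g m
  rwa [MvPolynomial.coe_basisMonomials] at this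

theorem functional_monomial (g : (σ →₀ ℕ) → ℝ) (m : σ →₀ ℕ) (c : ℕ) :
    functional g (MvPolynomial.monomial m c) = c * g m := by
  have : MvPolynomial.monomial m c = c • (MvPolynomial.monomial m 1 : MvPolynomial σ ℕ) := by
    rw [MvPolynomial.smul_monomial, smul_eq_mul, mul_one]
  rw [this, map_nsmul, functional_monomial_one, nsmul_eq_mul]

theorem functional_one (g : (σ →₀ ℕ) → ℝ) : functional g 1 = g 0 := by
  rw [MvPolynomial.one_def, functional_monomial_one]

theorem functional_eq_sum (g : (σ →₀ ℕ) → ℝ) (P : MvPolynomial σ ℕ) :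
    functional g P = ∑ m ∈ P.support, ((P.coeff m : ℕ) : ℝ) * g m := by
  conv_lhs => rw [P.as_sum, map_sum]
  exact Finset.sum_congr rfl fun m _ => functional_monomial _ _ _

theorem functional_mono {g h : (σ →₀ ℕ) → ℝ} {P : MvPolynomial σ ℕ}
    (hgh : ∀ m ∈ P.support, g m ≤ h m) : functional g P ≤ functional h P := by
  rw [functional_eq_sum, functional_eq_sum]
  exact Finset.sum_le_sum fun m hm => mul_le_mul_of_nonneg_left (hgh m hm) (Nat.cast_nonneg _)

theorem functional_congr {g h : (σ →₀ ℕ) → ℝ} {P : MvPolynomial σ ℕ}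
    (hgh : ∀ m ∈ P.support, g m = h m) : functional g P = functional h P :=
  le_antisymm (functional_mono fun m hm => (hgh m hm).le)
    (functional_mono fun m hm => (hgh m hm).ge)

theorem functional_nonneg {g : (σ →₀ ℕ) → ℝ} (hg : ∀ m, 0 ≤ g m) (P : MvPolynomial σ ℕ) :
    0 ≤ functional g P := by
  rw [functional_eq_sum]
  exact Finset.sum_nonneg fun m _ => mul_nonneg (Nat.cast_nonneg _) (hg m)

theorem functional_le_of_dom {g : (σ →₀ ℕ) → ℝ} (hg : ∀ m, 0 ≤ g m) {P Q : MvPolynomial σ ℕ}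
    (h : Dom P Q) : functional g P ≤ functional g Q := by
  obtain ⟨R, rfl⟩ := h
  rw [map_add]
  linarith [functional_nonneg hg R]

theorem abs_functional_le (g : (σ →₀ ℕ) → ℝ) (P : MvPolynomial σ ℕ) :
    |functional g P| ≤ functional (fun m => |g m|) P := by
  rw [functional_eq_sum, functional_eq_sum]
  refine (Finset.abs_sum_le_sum_abs _ _).trans (le_of_eq ?_)
  exact Finset.sum_congr rfl fun m _ => by rw [abs_mul, Nat.abs_cast]

theorem functional_const_mul (c : ℝ) (g : (σ →₀ ℕ) → ℝ) (P : MvPolynomial σ ℕ) :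
    functional (fun m => c * g m) P = c * functional g P := by
  rw [functional_eq_sum, functional_eq_sum, Finset.mul_sum]
  exact Finset.sum_congr rfl fun m _ => by ring

theorem functional_sub (g h : (σ →₀ ℕ) → ℝ) (P : MvPolynomial σ ℕ) :
    functional (fun m => g m - h m) P = functional g P - functional h P := by
  rw [functional_eq_sum, functional_eq_sum, functional_eq_sum, ← Finset.sum_sub_distrib]
  exact Finset.sum_congr rfl fun m _ => by ring

theorem functional_mul (g : (σ →₀ ℕ) → ℝ) (P Q : MvPolynomial σ ℕ) :
    functional g (P * Q) = functional (fun m => functional (fun m' => g (m + m')) Q) P := by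
  induction P using MvPolynomial.induction_on' with
  | add P₁ P₂ h₁ h₂ => rw [add_mul, map_add, map_add, h₁, h₂]
  | monomial m a =>
    rw [functional_monomial]
    induction Q using MvPolynomial.induction_on' with
    | add Q₁ Q₂ h₁ h₂ => rw [mul_add, map_add, map_add, h₁, h₂, mul_add]
    | monomial m' a' =>
      rw [MvPolynomial.monomial_mul, functional_monomial, functional_monomial]
      push_cast
      ring

theorem functional_mul_functional (g h : (σ →₀ ℕ) → ℝ) (P Q : MvPolynomial σ ℕ) :
    functional g P * functional h Q =
      functional (fun m => functional (fun m' => g m * h m') Q) P := by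
  simp only [functional_const_mul]
  rw [mul_comm, ← functional_const_mul]
  exact functional_congr fun m _ => mul_comm _ _

theorem functional_X_mul (g : (σ →₀ ℕ) → ℝ) (e : σ) (P : MvPolynomial σ ℕ) :
    functional g (MvPolynomial.X e * P) = functional (fun m => g (Finsupp.single e 1 + m)) P := by
  rw [functional_mul, MvPolynomial.X, functional_monomial_one]

/-- All monomials of a polynomial dominated by a homogeneous one have its degree. -/
theorem degree_of_dom {P Q : MvPolynomial σ ℕ} {n : ℕ} (h : Dom P Q) (hQ : Q.IsHomogeneous n)
    {m : σ →₀ ℕ} (hm : m ∈ P.support) : m.degree = n := by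
  obtain ⟨R, rfl⟩ := h
  have h1 : MvPolynomial.coeff m (P + R) ≠ 0 := by
    rw [MvPolynomial.coeff_add]
    have := MvPolynomial.mem_support_iff.1 hm
    omega
  have := hQ h1
  exact (congrArg (fun f : (σ →₀ ℕ) →+ ℕ => f m)
    (Finsupp.degree_eq_weight_one (σ := σ) (R := ℕ))).trans this

/-! ### Counting edges with weight `1 / N` -/

variable [DecidableEq σ]

/-- The weight `N ^ (-e)` of a monomial, where `e` is the number of variables which occur in it and
do not belong to the set `T` of variables seen before. -/
def edgeWeight (N : ℕ) (T : Finset σ) (m : σ →₀ ℕ) : ℝ := ((N : ℝ)⁻¹) ^ (m.support \ T).card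

theorem edgeWeight_nonneg (N : ℕ) (T : Finset σ) (m : σ →₀ ℕ) : 0 ≤ edgeWeight N T m := by
  unfold edgeWeight; positivity

theorem edgeWeight_zero (N : ℕ) (T : Finset σ) : edgeWeight N T 0 = 1 := by
  simp [edgeWeight]

theorem support_single_add (e : σ) (m : σ →₀ ℕ) :
    (Finsupp.single e 1 + m).support = insert e m.support := by
  rw [Finsupp.support_add_eq_union, Finsupp.support_single _ one_ne_zero,
    Finset.singleton_union]

theorem edgeWeight_single_add_of_mem {N : ℕ} {T : Finset σ} {e : σ} (he : e ∈ T) (m : σ →₀ ℕ) :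
    edgeWeight N T (Finsupp.single e 1 + m) = edgeWeight N T m := by
  rw [edgeWeight, edgeWeight, support_single_add, Finset.insert_sdiff_of_mem _ he]

theorem edgeWeight_single_add_of_notMem {N : ℕ} {T : Finset σ} {e : σ} (he : e ∉ T)
    (m : σ →₀ ℕ) :
    edgeWeight N T (Finsupp.single e 1 + m) = (N : ℝ)⁻¹ * edgeWeight N (insert e T) m := by
  rw [edgeWeight, edgeWeight, support_single_add, ← pow_succ']
  congr 1
  rw [Finset.insert_sdiff_of_notMem _ he, Finset.sdiff_insert]
  rw [← Finset.card_insert_of_notMem (Finset.notMem_erase e (m.support \ T))]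
  congr 1
  ext x
  by_cases hx : x = e <;> simp [hx]

theorem edgeWeight_add (N : ℕ) (T : Finset σ) (m m' : σ →₀ ℕ) :
    edgeWeight N T (m + m') = edgeWeight N T m * edgeWeight N (T ∪ m.support) m' := by
  rw [edgeWeight, edgeWeight, edgeWeight, ← pow_add, Finsupp.support_add_eq_union]
  congr 1
  rw [← Finset.card_union_of_disjoint]
  · congr 1
    ext x
    simp only [Finset.mem_sdiff, Finset.mem_union]
    tauto
  · rw [Finset.disjoint_left]
    intro x
    simp only [Finset.mem_sdiff, Finset.mem_union]
    tauto

theorem edgeWeight_anti {N : ℕ} (hN : 1 ≤ N) {T T' : Finset σ} (h : T ⊆ T') (m : σ →₀ ℕ) :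
    edgeWeight N T m ≤ edgeWeight N T' m := by
  refine pow_le_pow_of_le_one (by positivity) (inv_le_one_of_one_le₀ (by exact_mod_cast hN))
    (Finset.card_le_card (Finset.sdiff_subset_sdiff (Finset.Subset.refl _) h))

end Functional

section Walks

/-! ### Sums over walks, weighted by the number of edges -/

/-- The matrix of independent commuting variables supported on the pairs related by `adj`.  The
entries of its powers enumerate the walks along `adj`, with the edges recorded as a monomial. -/
def walkMatrix {N : ℕ} (adj : Fin N → Fin N → Prop) :
    Matrix (Fin N) (Fin N) (MvPolynomial (Sym2 (Fin N)) ℕ) :=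
  open Classical in Matrix.of fun i j => if adj i j then MvPolynomial.X s(i, j) else 0

theorem walkMatrix_of_adj {N : ℕ} {adj : Fin N → Fin N → Prop} {i j : Fin N} (h : adj i j) :
    walkMatrix adj i j = MvPolynomial.X s(i, j) := by simp [walkMatrix, h]

theorem walkMatrix_of_not_adj {N : ℕ} {adj : Fin N → Fin N → Prop} {i j : Fin N}
    (h : ¬ adj i j) : walkMatrix adj i j = 0 := by simp [walkMatrix, h]

/-- Every edge of `T` has both its ends in `U`. -/
def EdgesIn {V : Type*} (U : Finset V) (T : Finset (Sym2 V)) : Prop := ∀ e ∈ T, ∀ v ∈ e, v ∈ U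

theorem EdgesIn.insert {V : Type*} [DecidableEq V] {U : Finset V} {T : Finset (Sym2 V)}
    (h : EdgesIn U T) {x k : V} (hx : x ∈ U) : EdgesIn (insert k U) (insert s(x, k) T) := by
  intro e he v hv
  rcases Finset.mem_insert.1 he with rfl | he
  · rcases Sym2.mem_iff.1 hv with rfl | rfl
    · exact Finset.mem_insert_of_mem hx
    · exact Finset.mem_insert_self _ _
  · exact Finset.mem_insert_of_mem (h e he v hv)

theorem EdgesIn.notMem {V : Type*} {U : Finset V} {T : Finset (Sym2 V)}
    (h : EdgesIn U T) {x k : V} (hk : k ∉ U) : s(x, k) ∉ T :=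
  fun he => hk (h _ he k (Sym2.mem_mk_right x k))

variable {N : ℕ}

/-- The general step-by-step estimate for a sum over walks of length `n` from `x`, followed by a
factor `Q y` depending on the end `y`.  The state of the exploration consists of the set `U` of
visited vertices and the set `T` of traversed edges; it satisfies the invariant `Inv`.  A step to a
new vertex has `N` choices and costs a new edge, that is a factor `1 / N`; a step to a visited
vertex has boundedly many choices.  A step into the target set `W` ends the exploration, and its
contribution is estimated by hypothesis. -/
theorem walk_le (hN : 1 ≤ N) (adj : Fin N → Fin N → Prop)
    (Inv : Finset (Fin N) → Finset (Sym2 (Fin N)) → Prop) (W : Finset (Fin N))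
    (h : Finset (Sym2 (Fin N)) → (Sym2 (Fin N) →₀ ℕ) → ℝ) (h0 : ∀ T m, 0 ≤ h T m)
    (Q : Fin N → MvPolynomial (Sym2 (Fin N)) ℕ) (K : ℕ) (c : ℝ) (hc : 0 ≤ c) (hW : W.card ≤ K)
    (hstep : ∀ U T x k, Inv U T → x ∈ U → adj x k → k ∉ W →
      Inv (insert k U) (insert s(x, k) T))
    (hnew : ∀ U T x k, Inv U T → x ∈ U → adj x k → k ∉ W → k ∉ U → s(x, k) ∉ T)
    (hh : ∀ U T x k, Inv U T → x ∈ U → adj x k → k ∉ W → ∀ m,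
      h T (Finsupp.single s(x, k) 1 + m) = h (insert s(x, k) T) m)
    (hend : ∀ U T y, U.card ≤ K → Inv U T → y ∈ U →
      functional (fun m => edgeWeight N T m * h T m) (Q y) ≤ c)
    (hhit : ∀ U T x k n, Inv U T → x ∈ U → adj x k → k ∈ W → U.card + (n + 1) ≤ K →
      functional (fun m => edgeWeight N T (Finsupp.single s(x, k) 1 + m) *
        h T (Finsupp.single s(x, k) 1 + m)) (∑ y, (walkMatrix adj ^ n) k y * Q y) ≤
          (2 * K + 1) ^ n * c)
    (n : ℕ) (U : Finset (Fin N)) (T : Finset (Sym2 (Fin N))) (x : Fin N) (hI : Inv U T)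
    (hx : x ∈ U) (hK : U.card + n ≤ K) :
    functional (fun m => edgeWeight N T m * h T m) (∑ y, (walkMatrix adj ^ n) x y * Q y) ≤
      (2 * K + 1) ^ n * c := by
  have hNpos : (0 : ℝ) < N := by exact_mod_cast hN
  induction n generalizing U T x with
  | zero =>
    have : ∑ y, (walkMatrix adj ^ 0) x y * Q y = Q x := by
      simp [Matrix.one_apply]
    rw [this]
    simpa using hend U T x (by omega) hI hx
  | succ n ih =>
    set b : ℝ := (2 * K + 1) ^ n * c with hb
    have hb0 : 0 ≤ b := by positivity
    have hexp : ∑ y, (walkMatrix adj ^ (n + 1)) x y * Q y =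
        ∑ k, walkMatrix adj x k * ∑ y, (walkMatrix adj ^ n) k y * Q y := by
      simp only [pow_succ', Matrix.mul_apply, Finset.sum_mul, Finset.mul_sum]
      rw [Finset.sum_comm]
      exact Finset.sum_congr rfl fun _ _ => Finset.sum_congr rfl fun _ _ => by ring
    rw [hexp, map_sum]
    have hk : ∀ k ∈ (Finset.univ : Finset (Fin N)),
        functional (fun m => edgeWeight N T m * h T m)
          (walkMatrix adj x k * ∑ y, (walkMatrix adj ^ n) k y * Q y) ≤
        (if k ∈ U then b else 0) + (if k ∈ W then b else 0) + (N : ℝ)⁻¹ * b := by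
      intro k _
      have hp1 : 0 ≤ if k ∈ U then b else 0 := by split_ifs <;> simp [hb0]
      have hp2 : 0 ≤ if k ∈ W then b else 0 := by split_ifs <;> simp [hb0]
      have hp3 : 0 ≤ (N : ℝ)⁻¹ * b := by positivity
      by_cases hadj : adj x k
      swap
      · rw [walkMatrix_of_not_adj hadj, zero_mul, map_zero]
        linarith
      rw [walkMatrix_of_adj hadj, functional_X_mul]
      by_cases hkW : k ∈ W
      · have := hhit U T x k n hI hx hadj hkW hK
        rw [if_pos hkW]
        linarith
      by_cases hkU : k ∈ U
      · have h1 := ih U (insert s(x, k) T) k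
          (by simpa [Finset.insert_eq_of_mem hkU] using hstep U T x k hI hx hadj hkW) hkU (by omega)
        have h2 : functional (fun m => edgeWeight N T (Finsupp.single s(x, k) 1 + m) *
            h T (Finsupp.single s(x, k) 1 + m)) (∑ y, (walkMatrix adj ^ n) k y * Q y) ≤
            functional (fun m => edgeWeight N (insert s(x, k) T) m * h (insert s(x, k) T) m)
              (∑ y, (walkMatrix adj ^ n) k y * Q y) := by
          refine functional_mono fun m _ => ?_
          rw [hh U T x k hI hx hadj hkW]
          refine mul_le_mul_of_nonneg_right ?_ (h0 _ _)
          by_cases he : s(x, k) ∈ T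
          · rw [edgeWeight_single_add_of_mem he, Finset.insert_eq_of_mem he]
          · rw [edgeWeight_single_add_of_notMem he]
            exact mul_le_of_le_one_left (edgeWeight_nonneg _ _ _)
              (inv_le_one_of_one_le₀ (by exact_mod_cast hN))
        rw [if_pos hkU]
        linarith
      · have h1 := ih (insert k U) (insert s(x, k) T) k (hstep U T x k hI hx hadj hkW)
          (Finset.mem_insert_self _ _) (by rw [Finset.card_insert_of_notMem hkU]; omega)
        have h2 : functional (fun m => edgeWeight N T (Finsupp.single s(x, k) 1 + m) *
            h T (Finsupp.single s(x, k) 1 + m)) (∑ y, (walkMatrix adj ^ n) k y * Q y) =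
            (N : ℝ)⁻¹ * functional (fun m => edgeWeight N (insert s(x, k) T) m *
              h (insert s(x, k) T) m) (∑ y, (walkMatrix adj ^ n) k y * Q y) := by
          rw [← functional_const_mul]
          refine functional_congr fun m _ => ?_
          rw [hh U T x k hI hx hadj hkW,
            edgeWeight_single_add_of_notMem (hnew U T x k hI hx hadj hkW hkU), mul_assoc]
        rw [h2]
        have h3 := mul_le_mul_of_nonneg_left h1 (inv_nonneg.2 hNpos.le)
        linarith
    refine (Finset.sum_le_sum hk).trans ?_
    rw [Finset.sum_add_distrib, Finset.sum_add_distrib]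
    simp only [Finset.sum_ite_mem, Finset.univ_inter, Finset.sum_const, nsmul_eq_mul,
      Finset.card_univ, Fintype.card_fin]
    have hU : (U.card : ℝ) ≤ K := by exact_mod_cast (by omega : U.card ≤ K)
    have hW' : (W.card : ℝ) ≤ K := by exact_mod_cast hW
    have e1 : (N : ℝ) * ((N : ℝ)⁻¹ * b) = b := by field_simp
    rw [e1, pow_succ]
    nlinarith

/-- A walk starting at a visited vertex, followed by factors which are bounded in all later
states. -/
theorem walk_cont_le (hN : 1 ≤ N) (adj : Fin N → Fin N → Prop) (U₀ : Finset (Fin N))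
    (h : Finset (Sym2 (Fin N)) → ℝ) (h0 : ∀ T, 0 ≤ h T)
    (Q : Fin N → MvPolynomial (Sym2 (Fin N)) ℕ) (K : ℕ) (c : ℝ) (hc : 0 ≤ c)
    (hend : ∀ U T y, U.card ≤ K → EdgesIn U T → U₀ ⊆ U → y ∈ U →
      functional (fun m => edgeWeight N T m * h (T ∪ m.support)) (Q y) ≤ c)
    (n : ℕ) (U : Finset (Fin N)) (T : Finset (Sym2 (Fin N))) (x : Fin N) (hT : EdgesIn U T)
    (hU₀ : U₀ ⊆ U) (hx : x ∈ U) (hK : U.card + n ≤ K) :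
    functional (fun m => edgeWeight N T m * h (T ∪ m.support))
      (∑ y, (walkMatrix adj ^ n) x y * Q y) ≤ (2 * K + 1) ^ n * c := by
  refine walk_le hN adj (fun U T => EdgesIn U T ∧ U₀ ⊆ U) ∅ (fun T m => h (T ∪ m.support))
    (fun _ _ => h0 _) Q K c hc (by simp) ?_ ?_ ?_ ?_ ?_ n U T x ⟨hT, hU₀⟩ hx hK
  · intro U T x k hI hx _ _
    exact ⟨hI.1.insert hx, hI.2.trans (Finset.subset_insert _ _)⟩
  · intro U T x k hI _ _ _ hk
    exact hI.1.notMem hk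
  · intro U T x k _ _ _ _ m
    rw [support_single_add, Finset.union_insert, Finset.insert_union]
  · intro U T y hU hI hy
    exact hend U T y hU hI.1 hI.2 hy
  · intro U T x k n _ _ _ hk
    simp at hk

/-- The sum over all walks of length `n` from a visited vertex is bounded. -/
theorem walk_sum_le (hN : 1 ≤ N) (adj : Fin N → Fin N → Prop) (K n : ℕ) (U : Finset (Fin N))
    (T : Finset (Sym2 (Fin N))) (x : Fin N) (hT : EdgesIn U T) (hx : x ∈ U)
    (hK : U.card + n ≤ K) :
    functional (edgeWeight N T) (∑ y, (walkMatrix adj ^ n) x y) ≤ (2 * K + 1) ^ n := by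
  have := walk_cont_le hN adj ∅ (fun _ => 1) (fun _ => zero_le_one) (fun _ => 1) K 1 zero_le_one
    (fun U T y _ _ _ _ => by
      simp only [mul_one, functional_one, edgeWeight_zero, le_refl]) n U T x hT
    (Finset.empty_subset _) hx hK
  simpa using this

/-- A closed walk is one of the walks from its root. -/
theorem dom_walk_sum (adj : Fin N → Fin N → Prop) (n : ℕ) (x : Fin N) :
    Dom ((walkMatrix adj ^ n) x x) (∑ y, (walkMatrix adj ^ n) x y) :=
  Dom.single_sum (Finset.mem_univ x) fun y => (walkMatrix adj ^ n) x y

theorem closedWalk_le (hN : 1 ≤ N) (adj : Fin N → Fin N → Prop) (K n : ℕ) (U : Finset (Fin N))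
    (T : Finset (Sym2 (Fin N))) (x : Fin N) (hT : EdgesIn U T) (hx : x ∈ U)
    (hK : U.card + n ≤ K) :
    functional (edgeWeight N T) ((walkMatrix adj ^ n) x x) ≤ (2 * K + 1) ^ n :=
  (functional_le_of_dom (edgeWeight_nonneg N T) (dom_walk_sum adj n x)).trans
    (walk_sum_le hN adj K n U T x hT hx hK)

/-- Two closed walks at visited vertices. -/
theorem closedWalk_mul_closedWalk_le (hN : 1 ≤ N) (adj : Fin N → Fin N → Prop) (K n n' : ℕ)
    (U : Finset (Fin N)) (T : Finset (Sym2 (Fin N))) (x x' : Fin N) (hT : EdgesIn U T)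
    (hx : x ∈ U) (hx' : x' ∈ U) (hK : U.card + n + n' ≤ K) :
    functional (edgeWeight N T) ((walkMatrix adj ^ n) x x * (walkMatrix adj ^ n') x' x') ≤
      (2 * K + 1) ^ n * (2 * K + 1) ^ n' := by
  have h1 := walk_cont_le hN adj {x'} (fun _ => 1) (fun _ => zero_le_one)
    (fun _ => (walkMatrix adj ^ n') x' x') (K - n') ((2 * K + 1) ^ n') (by positivity)
    (fun U T y hU hT hU₀ _ => by
      simpa only [mul_one] using closedWalk_le hN adj K n' U T x' hT
        (Finset.singleton_subset_iff.1 hU₀) (by omega)) n U T x hT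
    (Finset.singleton_subset_iff.2 hx') hx (by omega)
  simp only [mul_one] at h1
  have h2 : Dom ((walkMatrix adj ^ n) x x * (walkMatrix adj ^ n') x' x')
      (∑ y, (walkMatrix adj ^ n) x y * (walkMatrix adj ^ n') x' x') :=
    Dom.single_sum (Finset.mem_univ x) fun y =>
      (walkMatrix adj ^ n) x y * (walkMatrix adj ^ n') x' x'
  refine (functional_le_of_dom (edgeWeight_nonneg N T) h2).trans (h1.trans ?_)
  gcongr
  omega

/-- Weight of the walks which use an edge of `T'`, where the edges of `T` are not counted. -/
def hitWeight (N : ℕ) (T T' : Finset (Sym2 (Fin N))) (m : Sym2 (Fin N) →₀ ℕ) : ℝ :=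
  edgeWeight N T m * if Disjoint m.support T' then 0 else 1

theorem hitWeight_nonneg (T T' : Finset (Sym2 (Fin N))) (m : Sym2 (Fin N) →₀ ℕ) :
    0 ≤ hitWeight N T T' m :=
  mul_nonneg (edgeWeight_nonneg _ _ _) (by split_ifs <;> simp)

theorem hitWeight_le (T T' : Finset (Sym2 (Fin N))) (m : Sym2 (Fin N) →₀ ℕ) :
    hitWeight N T T' m ≤ edgeWeight N T m :=
  mul_le_of_le_one_right (edgeWeight_nonneg _ _ _) (by split_ifs <;> simp)

/-- A walk which starts away from the vertex set `U₁` and uses an edge inside `U₁` has to enter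
`U₁` by a new edge leading to an old vertex, which costs a factor `1 / N`. -/
theorem walk_hit_le (hN : 1 ≤ N) (adj : Fin N → Fin N → Prop) (K n : ℕ)
    (U₁ U₂ : Finset (Fin N)) (T T' : Finset (Sym2 (Fin N))) (x : Fin N) (hT' : EdgesIn U₁ T')
    (hU : Disjoint U₁ U₂)
    (hT : ∀ e ∈ T, (∀ v ∈ e, v ∈ U₁) ∨ (∀ v ∈ e, v ∈ U₂)) (hx : x ∈ U₂)
    (hK₁ : U₁.card ≤ K) (hK₂ : U₂.card + n ≤ K) :
    functional (hitWeight N T T') (∑ y, (walkMatrix adj ^ n) x y) ≤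
      (2 * K + 1) ^ n * ((4 * K + 1) ^ K * (N : ℝ)⁻¹) := by
  have hnew : ∀ (U : Finset (Fin N)) (T : Finset (Sym2 (Fin N))) (x k : Fin N),
      Disjoint U₁ U → (∀ e ∈ T, (∀ v ∈ e, v ∈ U₁) ∨ (∀ v ∈ e, v ∈ U)) → x ∈ U → k ∉ U →
      s(x, k) ∉ T := by
    intro U T x k hd hT hx hk he
    rcases hT _ he with h | h
    · exact Finset.disjoint_left.1 hd (h x (Sym2.mem_mk_left _ _)) hx
    · exact hk (h k (Sym2.mem_mk_right _ _))
  have := walk_le hN adj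
    (fun U T => Disjoint U₁ U ∧ ∀ e ∈ T, (∀ v ∈ e, v ∈ U₁) ∨ (∀ v ∈ e, v ∈ U)) U₁
    (fun _ m => if Disjoint m.support T' then 0 else 1) (fun _ _ => by split_ifs <;> simp)
    (fun _ => 1) K ((4 * K + 1) ^ K * (N : ℝ)⁻¹) (by positivity) hK₁ ?_ ?_ ?_ ?_ ?_ n U₂ T x
    ⟨hU, hT⟩ hx hK₂
  · simp only [mul_one] at this
    exact this
  · intro U T x k hI hx _ hk
    refine ⟨Finset.disjoint_insert_right.2 ⟨hk, hI.1⟩, ?_⟩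
    intro e he
    rcases Finset.mem_insert.1 he with rfl | he
    · right
      intro v hv
      rcases Sym2.mem_iff.1 hv with rfl | rfl
      · exact Finset.mem_insert_of_mem hx
      · exact Finset.mem_insert_self _ _
    · rcases hI.2 e he with h | h
      · exact Or.inl h
      · exact Or.inr fun v hv => Finset.mem_insert_of_mem (h v hv)
  · intro U T x k hI hx _ _ hk
    exact hnew U T x k hI.1 hI.2 hx hk
  · intro U T x k hI hx _ hk m
    have : s(x, k) ∉ T' := hT'.notMem hk
    simp only [support_single_add, Finset.disjoint_insert_left, this, not_false_eq_true, true_and]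
  · intro U T y _ _ _
    simp only [functional_one, Finsupp.support_zero, Finset.disjoint_empty_left, if_true, mul_zero]
    positivity
  · intro U T x k n' hI hx _ hk hK'
    have hkU : k ∉ U := Finset.disjoint_left.1 hI.1 hk
    have he := hnew U T x k hI.1 hI.2 hx hkU
    have hin : EdgesIn (U₁ ∪ U) (insert s(x, k) T) := by
      intro e he v hv
      rcases Finset.mem_insert.1 he with rfl | he
      · rcases Sym2.mem_iff.1 hv with rfl | rfl
        · exact Finset.mem_union_right _ hx
        · exact Finset.mem_union_left _ hk
      · rcases hI.2 e he with h | h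
        · exact Finset.mem_union_left _ (h v hv)
        · exact Finset.mem_union_right _ (h v hv)
    have hcard : (U₁ ∪ U).card + n' ≤ 2 * K := by
      have := Finset.card_union_le U₁ U
      omega
    have h1 := walk_sum_le hN adj (2 * K) n' (U₁ ∪ U) (insert s(x, k) T) k hin
      (Finset.mem_union_left _ hk) hcard
    have h2 : functional (fun m => edgeWeight N T (Finsupp.single s(x, k) 1 + m) *
        if Disjoint (Finsupp.single s(x, k) 1 + m).support T' then 0 else 1)
          (∑ y, (walkMatrix adj ^ n') k y * 1) ≤
        (N : ℝ)⁻¹ * functional (edgeWeight N (insert s(x, k) T))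
          (∑ y, (walkMatrix adj ^ n') k y) := by
      simp only [mul_one]
      rw [← functional_const_mul]
      refine functional_mono fun m _ => ?_
      rw [edgeWeight_single_add_of_notMem he]
      refine mul_le_of_le_one_right ?_ (by split_ifs <;> simp)
      exact mul_nonneg (by positivity) (edgeWeight_nonneg _ _ _)
    refine h2.trans ?_
    have h3 : (2 * ((2 * K : ℕ) : ℝ) + 1) ^ n' ≤ (4 * K + 1) ^ K := by
      push_cast
      rw [show (2 * (2 * (K : ℝ)) + 1) = 4 * K + 1 by ring]
      exact pow_le_pow_right₀ (by linarith [Nat.cast_nonneg (α := ℝ) K]) (by omega)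
    have h4 : (1 : ℝ) ≤ (2 * K + 1) ^ n' :=
      one_le_pow₀ (by linarith [Nat.cast_nonneg (α := ℝ) K])
    calc (N : ℝ)⁻¹ * functional (edgeWeight N (insert s(x, k) T))
          (∑ y, (walkMatrix adj ^ n') k y) ≤ (N : ℝ)⁻¹ * (4 * K + 1) ^ K := by
          gcongr
          exact h1.trans h3
      _ = 1 * ((4 * K + 1) ^ K * (N : ℝ)⁻¹) := by ring
      _ ≤ _ := by gcongr

/-- Pairs of walks from two different vertices which share an edge have total weight `O(1 / N)`.
Either the first walk visits the start of the second one, or the second one has to enter the set of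
vertices visited by the first one; both cost an edge without a new vertex. -/
theorem walk_pair_hit_le (a b : ℕ) : ∃ c : ℝ, 0 ≤ c ∧ ∀ (N : ℕ), 1 ≤ N →
    ∀ (adj : Fin N → Fin N → Prop) (i j : Fin N), i ≠ j →
    functional (fun m => edgeWeight N ∅ m * functional (hitWeight N m.support m.support)
      (∑ z, (walkMatrix adj ^ b) j z)) (∑ y, (walkMatrix adj ^ a) i y) ≤ c * (N : ℝ)⁻¹ := by
  set K := a + b + 2 with hK
  set c₁ : ℝ := (2 * K + 1) ^ K with hc₁
  set c₂ : ℝ := (2 * K + 1) ^ K * (4 * K + 1) ^ K with hc₂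
  refine ⟨(2 * K + 1) ^ a * ((2 * K + 1) ^ K * (c₁ + c₂)), by positivity, ?_⟩
  intro N hN adj i j hij
  have hK1 : (1 : ℝ) ≤ 2 * K + 1 := by linarith [Nat.cast_nonneg (α := ℝ) K]
  set h : Finset (Sym2 (Fin N)) → ℝ := fun T => functional (hitWeight N T T)
    (∑ z, (walkMatrix adj ^ b) j z) with hh
  have h0 : ∀ T, 0 ≤ h T := fun T => functional_nonneg (hitWeight_nonneg _ _) _
  -- the second walk is bounded in every state in which its start has been visited
  have hbdd : ∀ (U : Finset (Fin N)) (T : Finset (Sym2 (Fin N))), U.card ≤ a + 2 → EdgesIn U T →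
      j ∈ U → h T ≤ c₁ := by
    intro U T hU hT hj
    refine (functional_mono fun m _ => hitWeight_le T T m).trans
      ((walk_sum_le hN adj K b U T j hT hj (by omega)).trans ?_)
    exact pow_le_pow_right₀ hK1 (by omega)
  have := walk_le hN adj (fun U T => EdgesIn U T ∧ j ∉ U) {j} (fun T m => h (T ∪ m.support))
    (fun _ _ => h0 _) (fun _ => 1) (a + 1)
    ((2 * K + 1) ^ K * (c₁ + c₂) * (N : ℝ)⁻¹) (by positivity) (by simp) ?_ ?_ ?_ ?_ ?_ a {i} ∅ i
    ⟨fun e he => by simp at he, by simpa using hij.symm⟩ (Finset.mem_singleton_self i)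
    (by simp; omega)
  · simp only [mul_one, Finset.empty_union] at this
    refine this.trans ?_
    rw [mul_assoc ((2 * (K : ℝ) + 1) ^ a)]
    gcongr
    omega
  · intro U T x k hI hx _ hk
    refine ⟨hI.1.insert hx, ?_⟩
    rw [Finset.mem_singleton] at hk
    rw [Finset.mem_insert, not_or]
    exact ⟨fun e => hk e.symm, hI.2⟩
  · intro U T x k hI _ _ _ hk
    exact hI.1.notMem hk
  · intro U T x k _ _ _ _ m
    rw [support_single_add, Finset.union_insert, Finset.insert_union]
  · intro U T y hU hI _
    simp only [functional_one, edgeWeight_zero, one_mul, Finsupp.support_zero, Finset.union_empty]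
    have h1 := walk_hit_le hN adj K b U {j} T T j hI.1 (Finset.disjoint_singleton_right.2 hI.2)
      (fun e he => Or.inl (hI.1 e he)) (Finset.mem_singleton_self j) (by omega) (by simp; omega)
    refine h1.trans ?_
    have h3 : (2 * (K : ℝ) + 1) ^ b ≤ (2 * K + 1) ^ K := pow_le_pow_right₀ hK1 (by omega)
    have h4 : (1 : ℝ) ≤ (2 * K + 1) ^ K := one_le_pow₀ hK1
    calc (2 * (K : ℝ) + 1) ^ b * ((4 * K + 1) ^ K * (N : ℝ)⁻¹) ≤
          (2 * K + 1) ^ K * ((4 * K + 1) ^ K * (N : ℝ)⁻¹) := by gcongr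
      _ = 1 * c₂ * (N : ℝ)⁻¹ := by rw [hc₂]; ring
      _ ≤ (2 * K + 1) ^ K * (c₁ + c₂) * (N : ℝ)⁻¹ := by
        have : 0 ≤ c₁ := by positivity
        gcongr
        linarith
  · intro U T x k n' hI hx _ hk hK'
    rw [Finset.mem_singleton] at hk
    subst hk
    have he : s(x, k) ∉ T := hI.1.notMem hI.2
    have h1 := walk_cont_le hN adj {k} h h0 (fun _ => 1) (a + 2) c₁ (by positivity)
      (fun U T y hU hT hU₀ _ => by
        simpa only [functional_one, edgeWeight_zero, one_mul, Finsupp.support_zero,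
          Finset.union_empty] using hbdd U T hU hT (Finset.singleton_subset_iff.1 hU₀))
      n' (insert k U) (insert s(x, k) T) k (hI.1.insert hx) (by simp) (Finset.mem_insert_self _ _)
      (by have := Finset.card_insert_le k U; omega)
    have h2 : functional (fun m => edgeWeight N T (Finsupp.single s(x, k) 1 + m) *
        h (T ∪ (Finsupp.single s(x, k) 1 + m).support))
          (∑ y, (walkMatrix adj ^ n') k y * 1) =
        (N : ℝ)⁻¹ * functional (fun m => edgeWeight N (insert s(x, k) T) m *
          h (insert s(x, k) T ∪ m.support)) (∑ y, (walkMatrix adj ^ n') k y * 1) := by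
      rw [← functional_const_mul]
      refine functional_congr fun m _ => ?_
      rw [edgeWeight_single_add_of_notMem he, support_single_add, Finset.union_insert,
        Finset.insert_union, mul_assoc]
    rw [h2]
    have h3 : (2 * ((a + 2 : ℕ) : ℝ) + 1) ^ n' ≤ (2 * K + 1) ^ K := by
      refine (pow_le_pow_left₀ (by positivity) ?_ n').trans (pow_le_pow_right₀ hK1 (by omega))
      have : ((a + 2 : ℕ) : ℝ) ≤ K := by exact_mod_cast (by omega : a + 2 ≤ K)
      linarith
    have h4 : (1 : ℝ) ≤ (2 * ((a + 1 : ℕ) : ℝ) + 1) ^ n' :=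
      one_le_pow₀ (by linarith [Nat.cast_nonneg (α := ℝ) (a + 1)])
    calc _ ≤ (N : ℝ)⁻¹ * ((2 * K + 1) ^ K * c₁) := by
          gcongr
          exact h1.trans (by gcongr)
      _ ≤ (N : ℝ)⁻¹ * ((2 * K + 1) ^ K * (c₁ + c₂)) := by
          have : 0 ≤ c₂ := by positivity
          gcongr
          linarith
      _ = 1 * ((2 * K + 1) ^ K * (c₁ + c₂) * (N : ℝ)⁻¹) := by ring
      _ ≤ _ := by gcongr

/-- An excursion from `i` which leaves along `s(i, j)` and comes back along another edge closes a
cycle; the total weight of such closed walks at `i` is `O(1 / N)`.  The relation `adj'` avoids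
`i`. -/
theorem cycle_le (n m : ℕ) : ∃ c : ℝ, 0 ≤ c ∧ ∀ (N : ℕ), 1 ≤ N →
    ∀ (adj adj' : Fin N → Fin N → Prop) (i : Fin N), (∀ x y, adj' x y → x ≠ i ∧ y ≠ i) →
    ¬ adj i i →
    functional (edgeWeight N ∅) (∑ j, walkMatrix adj i j * ∑ y, (walkMatrix adj' ^ n) j y *
      (if y = j then 0 else walkMatrix adj i y * (walkMatrix adj ^ m) i i)) ≤ c * (N : ℝ)⁻¹ := by
  set K := n + m + 2 with hK
  refine ⟨(2 * K + 1) ^ n * (2 * K + 1) ^ m, by positivity, ?_⟩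
  intro N hN adj adj' i hadj' hi
  have hNpos : (0 : ℝ) < N := by exact_mod_cast hN
  set b : ℝ := (2 * K + 1) ^ n * (2 * K + 1) ^ m * (N : ℝ)⁻¹ with hb
  have hb0 : 0 ≤ b := by positivity
  have key : ∀ j ∈ (Finset.univ : Finset (Fin N)), functional (edgeWeight N ∅)
      (walkMatrix adj i j * ∑ y, (walkMatrix adj' ^ n) j y *
        (if y = j then 0 else walkMatrix adj i y * (walkMatrix adj ^ m) i i)) ≤
      (N : ℝ)⁻¹ * b := by
    intro j _
    by_cases hij : adj i j
    swap
    · rw [walkMatrix_of_not_adj hij, zero_mul, map_zero]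
      positivity
    have hne : i ≠ j := by rintro rfl; exact hi hij
    rw [walkMatrix_of_adj hij, functional_X_mul]
    have e1 : (fun m' => edgeWeight N ∅ (Finsupp.single s(i, j) 1 + m')) =
        fun m' => (N : ℝ)⁻¹ * edgeWeight N {s(i, j)} m' := by
      funext m'
      rw [edgeWeight_single_add_of_notMem (Finset.notMem_empty _)]
      rfl
    rw [e1, functional_const_mul]
    refine mul_le_mul_of_nonneg_left ?_ (by positivity)
    have := walk_le hN adj'
      (fun U T => EdgesIn U T ∧ i ∈ U ∧ ∀ e ∈ T, i ∈ e → e = s(i, j)) ∅ (fun _ _ => 1)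
      (fun _ _ => zero_le_one)
      (fun y => if y = j then 0 else walkMatrix adj i y * (walkMatrix adj ^ m) i i) (n + 2)
      ((2 * K + 1) ^ m * (N : ℝ)⁻¹) (by positivity) (by simp) ?_ ?_ ?_ ?_ ?_ n {i, j} {s(i, j)} j
      ⟨?_, by simp, by simp⟩ (by simp) (by rw [Finset.card_pair hne]; omega)
    · simp only [mul_one] at this
      refine this.trans ?_
      rw [hb, mul_assoc]
      gcongr
      omega
    · intro U T x k hI hx hxk _
      refine ⟨hI.1.insert hx, Finset.mem_insert_of_mem hI.2.1, ?_⟩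
      intro e he hie
      rcases Finset.mem_insert.1 he with rfl | he
      · have := hadj' x k hxk
        rcases Sym2.mem_iff.1 hie with h | h
        · exact absurd h.symm this.1
        · exact absurd h.symm this.2
      · exact hI.2.2 e he hie
    · intro U T x k hI _ _ _ hk
      exact hI.1.notMem hk
    · intros; rfl
    · intro U T y hU hI hy
      simp only [mul_one]
      split_ifs with hyj
      · rw [map_zero]; positivity
      by_cases hiy : adj i y
      swap
      · rw [walkMatrix_of_not_adj hiy, zero_mul, map_zero]
        positivity
      rw [walkMatrix_of_adj hiy, functional_X_mul]
      have he : s(i, y) ∉ T := by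
        intro he
        have := hI.2.2 _ he (Sym2.mem_mk_left _ _)
        rw [Sym2.congr_right] at this
        exact hyj this
      have e2 : (fun m' => edgeWeight N T (Finsupp.single s(i, y) 1 + m')) =
          fun m' => (N : ℝ)⁻¹ * edgeWeight N (insert s(i, y) T) m' :=
        funext fun m' => edgeWeight_single_add_of_notMem he m'
      rw [e2, functional_const_mul, mul_comm]
      refine mul_le_mul_of_nonneg_right ?_ (by positivity)
      refine closedWalk_le hN adj K m U _ i ?_ hI.2.1 (by omega)
      have := hI.1.insert (k := y) hI.2.1
      rwa [Finset.insert_eq_of_mem hy] at this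
    · intro U T x k n' _ _ _ hk
      simp at hk
    · intro e he v hv
      rw [Finset.mem_singleton] at he
      subst he
      simpa using hv
  rw [map_sum]
  refine (Finset.sum_le_sum key).trans (le_of_eq ?_)
  rw [Finset.sum_const, nsmul_eq_mul, Finset.card_univ, Fintype.card_fin, hb]
  field_simp

/-- Closed walks at `i` which visit the prescribed neighbour `j` have weight `O(1 / N)`. -/
theorem pinned_le (a b : ℕ) : ∃ c : ℝ, 0 ≤ c ∧ ∀ (N : ℕ), 1 ≤ N →
    ∀ (adj : Fin N → Fin N → Prop) (i j : Fin N),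
    functional (edgeWeight N ∅) (walkMatrix adj i j ^ 2 * (walkMatrix adj ^ a) j j *
      (walkMatrix adj ^ b) i i) ≤ c * (N : ℝ)⁻¹ := by
  set K := a + b + 2 with hK
  refine ⟨(2 * K + 1) ^ a * (2 * K + 1) ^ b, by positivity, ?_⟩
  intro N hN adj i j
  by_cases hij : adj i j
  swap
  · rw [walkMatrix_of_not_adj hij, zero_pow two_ne_zero, zero_mul, zero_mul, map_zero]
    positivity
  rw [walkMatrix_of_adj hij, sq, mul_assoc, mul_assoc, functional_X_mul, functional_X_mul]
  have e1 : (fun m => edgeWeight N ∅ (Finsupp.single s(i, j) 1 +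
      (Finsupp.single s(i, j) 1 + m))) = fun m => (N : ℝ)⁻¹ * edgeWeight N {s(i, j)} m := by
    funext m
    rw [edgeWeight_single_add_of_notMem (Finset.notMem_empty _),
      edgeWeight_single_add_of_mem (Finset.mem_insert_self _ _)]
    rfl
  rw [e1, functional_const_mul, mul_comm]
  refine mul_le_mul_of_nonneg_right ?_ (by positivity)
  refine closedWalk_mul_closedWalk_le hN adj K a b {i, j} {s(i, j)} j i ?_ (by simp) (by simp) ?_
  · intro e he v hv
    rw [Finset.mem_singleton] at he
    subst he
    simpa using hv
  · have := Finset.card_le_two (a := i) (b := j)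
    omega

end Walks

section Series

/-! ### First returns of matrix powers -/

section FirstReturn

variable {R V : Type*} [CommSemiring R] [Fintype V] [DecidableEq V]

/-- Decomposition at the last visit of `i`: here `A'` is `A` with the row and the column of `i`
erased. -/
theorem pow_apply_eq_sum_of_ne (A A' : Matrix V V R) (i : V)
    (h' : ∀ x y, A' x y = if x = i ∨ y = i then 0 else A x y) (n : ℕ) (k : V) (hk : k ≠ i) :
    (A ^ n) k i = ∑ m ∈ Finset.range n, (∑ z, (A' ^ (n - 1 - m)) k z * A z i) * (A ^ m) i i := by
  induction n generalizing k with
  | zero => simp [Matrix.one_apply, hk]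
  | succ n ih =>
    rw [pow_succ', Matrix.mul_apply, ← Finset.add_sum_erase _ _ (Finset.mem_univ i),
      Finset.sum_range_succ, add_comm]
    congr 1
    · have h1 : ∀ x ∈ Finset.univ.erase i, A k x * (A ^ n) x i =
          ∑ m ∈ Finset.range n, (∑ z, A' k x * (A' ^ (n - 1 - m)) x z * A z i) *
            (A ^ m) i i := by
        intro x hx
        have hxi : x ≠ i := Finset.ne_of_mem_erase hx
        rw [ih x hxi, h' k x, if_neg (by tauto), Finset.mul_sum]
        refine Finset.sum_congr rfl fun m _ => ?_
        rw [← mul_assoc, Finset.mul_sum]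
        simp only [mul_assoc]
      rw [Finset.sum_congr rfl h1, Finset.sum_comm]
      refine Finset.sum_congr rfl fun m hm => ?_
      have hm' := Finset.mem_range.1 hm
      rw [← Finset.sum_mul, Finset.sum_comm]
      congr 1
      refine Finset.sum_congr rfl fun z _ => ?_
      rw [show n + 1 - 1 - m = (n - 1 - m) + 1 by omega, pow_succ', Matrix.mul_apply,
        ← Finset.sum_mul]
      congr 1
      rw [← Finset.add_sum_erase _ _ (Finset.mem_univ i), h' k i]
      simp
    · simp [Matrix.one_apply]

/-- A closed walk at `i` is a closed walk at `i` followed by an excursion, which spends the time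
between its first and its last step away from `i`. -/
theorem pow_succ_apply_self_eq_sum (A A' : Matrix V V R) (i : V)
    (h' : ∀ x y, A' x y = if x = i ∨ y = i then 0 else A x y) (hi : A i i = 0) (n : ℕ) :
    (A ^ (n + 1)) i i = ∑ m ∈ Finset.range n,
      (∑ x, ∑ z, A i x * (A' ^ (n - 1 - m)) x z * A z i) * (A ^ m) i i := by
  rw [pow_succ', Matrix.mul_apply]
  have h1 : ∀ x ∈ Finset.univ, A i x * (A ^ n) x i =
      ∑ m ∈ Finset.range n, (∑ z, A i x * (A' ^ (n - 1 - m)) x z * A z i) * (A ^ m) i i := by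
    intro x _
    by_cases hx : x = i
    · subst hx
      simp [hi]
    · rw [pow_apply_eq_sum_of_ne A A' i h' n x hx, Finset.mul_sum]
      refine Finset.sum_congr rfl fun m _ => ?_
      rw [← mul_assoc, Finset.mul_sum]
      simp only [mul_assoc]
  rw [Finset.sum_congr rfl h1, Finset.sum_comm]
  exact Finset.sum_congr rfl fun m _ => by rw [Finset.sum_mul]

theorem sum_range_two_mul_add_one (f : ℕ → R) (hf : ∀ n, f (2 * n + 1) = 0) (n : ℕ) :
    ∑ m ∈ Finset.range (2 * n + 1), f m = ∑ w ∈ Finset.range (n + 1), f (2 * w) := by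
  induction n with
  | zero => simp
  | succ n ih =>
    rw [show 2 * (n + 1) + 1 = (2 * n + 1) + 1 + 1 by ring, Finset.sum_range_succ,
      Finset.sum_range_succ, ih, hf, add_zero, Finset.sum_range_succ _ (n + 1)]
    congr 2

end FirstReturn

/-! ### Power series with vanishing constant term -/

section Geometric

variable {R : Type*} [CommSemiring R] {E G : PowerSeries R}

theorem coeff_pow_eq_zero (hE : PowerSeries.X ∣ E) {l r : ℕ} (h : l < r) :
    PowerSeries.coeff l (E ^ r) = 0 := by
  have h1 : (PowerSeries.X : PowerSeries R) ^ r ∣ E ^ r := pow_dvd_pow_of_dvd hE r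
  exact PowerSeries.X_pow_dvd_iff.1 h1 l h

/-- If `G = 1 + E G`, then the powers of `G` are the negative binomial series in `E`. -/
theorem pow_eq_sum_multichoose (hG : G = 1 + E * G) (f n : ℕ) :
    ∃ K, G ^ f = ∑ v ∈ Finset.range n, (Nat.multichoose f v : PowerSeries R) * E ^ v +
      E ^ n * K := by
  induction f generalizing n with
  | zero =>
    cases n with
    | zero => exact ⟨1, by simp⟩
    | succ n =>
      refine ⟨0, ?_⟩
      rw [Finset.sum_range_succ']
      simp
  | succ f ih =>
    induction n with
    | zero => exact ⟨G ^ (f + 1), by simp⟩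
    | succ n ihn =>
      obtain ⟨K₁, h₁⟩ := ih (n + 1)
      obtain ⟨K₂, h₂⟩ := ihn
      refine ⟨K₁ + K₂, ?_⟩
      have e1 : G ^ (f + 1) = G ^ f + E * G ^ (f + 1) := by
        calc G ^ (f + 1) = G ^ f * G := pow_succ _ _
          _ = G ^ f * (1 + E * G) := by rw [← hG]
          _ = _ := by ring
      rw [e1, h₁, h₂, Finset.sum_range_succ', Finset.sum_range_succ' _ n]
      simp only [Nat.multichoose_succ_succ, Nat.cast_add, add_mul, Finset.sum_add_distrib,
        Nat.multichoose_zero_right, mul_add, Finset.mul_sum]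
      have e2 : ∀ v, E * ((Nat.multichoose (f + 1) v : PowerSeries R) * E ^ v) =
          (Nat.multichoose (f + 1) v : PowerSeries R) * E ^ (v + 1) := fun v => by ring
      simp only [e2]
      ring

/-- The powers of `G` are finite sums coefficientwise, as `E` has no constant term. -/
theorem coeff_pow_succ_eq_sum_choose (hE : PowerSeries.X ∣ E) (hG : G = 1 + E * G) (f u : ℕ) :
    PowerSeries.coeff u (G ^ (f + 1)) =
      ∑ v ∈ Finset.range (u + 1), ((f + v).choose f : R) * PowerSeries.coeff u (E ^ v) := by
  obtain ⟨K, hK⟩ := pow_eq_sum_multichoose hG (f + 1) (u + 1)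
  have h1 : (PowerSeries.X : PowerSeries R) ^ (u + 1) ∣ E ^ (u + 1) * K :=
    Dvd.dvd.mul_right (pow_dvd_pow_of_dvd hE _) _
  rw [hK, map_add, PowerSeries.X_pow_dvd_iff.1 h1 u (by omega), add_zero, map_sum]
  refine Finset.sum_congr rfl fun v _ => ?_
  rw [Nat.multichoose_eq, show f + 1 + v - 1 = f + v by omega,
    Nat.choose_symm_of_eq_add (show f + v = f + v from rfl)]
  rw [← nsmul_eq_mul, ← nsmul_eq_mul, map_nsmul]

theorem dom_pow_of_eq (hG : G = 1 + E * G) (n : ℕ) : Dom (E ^ n) G := by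
  obtain ⟨K, hK⟩ := pow_eq_sum_multichoose hG 1 (n + 1)
  rw [pow_one, Finset.sum_range_succ] at hK
  refine ⟨∑ v ∈ Finset.range n, (Nat.multichoose 1 v : PowerSeries R) * E ^ v +
    E ^ (n + 1) * K, ?_⟩
  conv_lhs => rw [hK]
  simp only [Nat.multichoose_one, Nat.cast_one, one_mul]
  ring

/-- Removing a summand `O` from `E` changes the powers of `E` by a multiple of `O` which `G`
controls. -/
theorem exists_pow_eq_add (hG : G = 1 + E * G) {D O : PowerSeries R} (hE : E = D + O) (r : ℕ) :
    ∃ K, E ^ r = D ^ r + O * K ∧ Dom K (r * G) := by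
  induction r with
  | zero => exact ⟨0, by simp, Dom.zero_left _⟩
  | succ r ih =>
    obtain ⟨K, hK, hd⟩ := ih
    refine ⟨D ^ r + E * K, ?_, ?_⟩
    · rw [pow_succ', hK]
      nth_rewrite 1 [hE]
      rw [hE]
      ring
    · have h1 : Dom (D ^ r) G := (Dom.pow ⟨O, hE⟩ r).trans (dom_pow_of_eq hG r)
      have h2 : Dom (E * G) G := ⟨1, by rw [add_comm]; exact hG⟩
      have h3 : Dom (E * K) (r * G) := by
        refine ((Dom.refl E).mul hd).trans ?_
        rw [mul_left_comm]
        exact (Dom.refl _).mul h2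
      have := h1.add h3
      rwa [show ((r + 1 : ℕ) : PowerSeries R) * G = G + r * G by push_cast; ring]

/-- Expansion of a power of a sum by the index `j` of the first factor and the number `f + 1` of
factors with this index. -/
theorem sum_pow_succ_eq {R ι : Type*} [CommSemiring R] [DecidableEq ι] (s : Finset ι) (y : ι → R)
    (r : ℕ) :
    (∑ j ∈ s, y j) ^ (r + 1) = ∑ j ∈ s, ∑ f ∈ Finset.range (r + 1),
      (r.choose f : R) * (y j ^ (f + 1) * (∑ k ∈ s.erase j, y k) ^ (r - f)) := by
  rw [pow_succ', Finset.sum_mul]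
  refine Finset.sum_congr rfl fun j hj => ?_
  rw [← Finset.add_sum_erase _ _ hj, add_pow, Finset.mul_sum]
  exact Finset.sum_congr rfl fun f _ => by ring

end Geometric

section CoeffMem

variable {R : Type*} [CommSemiring R] (S : Subsemiring R)

/-- The power series with coefficients in a subsemiring. -/
def seriesIn : Subsemiring (PowerSeries R) where
  carrier := {a | ∀ n, PowerSeries.coeff n a ∈ S}
  zero_mem' := fun n => by simp
  one_mem' := fun n => by
    rw [PowerSeries.coeff_one]
    split_ifs
    exacts [S.one_mem, S.zero_mem]
  add_mem' := fun ha hb n => by rw [map_add]; exact S.add_mem (ha n) (hb n)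
  mul_mem' := fun ha hb n => by
    rw [PowerSeries.coeff_mul]
    exact S.sum_mem fun x _ => S.mul_mem (ha _) (hb _)

theorem X_mem_seriesIn : (PowerSeries.X : PowerSeries R) ∈ seriesIn S := fun n => by
  rw [PowerSeries.coeff_X]
  split_ifs
  exacts [S.one_mem, S.zero_mem]

theorem C_mem_seriesIn {a : R} (ha : a ∈ S) : PowerSeries.C a ∈ seriesIn S := fun n => by
  rw [PowerSeries.coeff_C]
  split_ifs
  exacts [ha, S.zero_mem]

theorem pow_apply_mem {V : Type*} [Fintype V] [DecidableEq V] {A : Matrix V V R}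
    (h : ∀ x y, A x y ∈ S) (n : ℕ) (x y : V) : (A ^ n) x y ∈ S := by
  induction n generalizing x with
  | zero =>
    rw [pow_zero, Matrix.one_apply]
    split_ifs
    exacts [S.one_mem, S.zero_mem]
  | succ n ih =>
    rw [pow_succ', Matrix.mul_apply]
    exact S.sum_mem fun k _ => S.mul_mem (h _ _) (ih _)

end CoeffMem

/-! ### Generating functions of closed walks on a bipartite graph -/

variable {N : ℕ}

/-- The complete bipartite graph of the colouring `col`, with the vertices of `F` removed. -/
def offAdj (col : Fin N → Bool) (F : Finset (Fin N)) (i j : Fin N) : Prop :=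
  i ∉ F ∧ j ∉ F ∧ col i ≠ col j

/-- The walk matrix of the bipartite graph without the vertices of `F`. -/
abbrev offMatrix (col : Fin N → Bool) (F : Finset (Fin N)) :
    Matrix (Fin N) (Fin N) (MvPolynomial (Sym2 (Fin N)) ℕ) := walkMatrix (offAdj col F)

/-- The generating function of the closed walks at `i` avoiding `F`; the variable marks two
steps. -/
def closedSeries (col : Fin N → Bool) (F : Finset (Fin N)) (i : Fin N) :
    PowerSeries (MvPolynomial (Sym2 (Fin N)) ℕ) :=
  PowerSeries.mk fun l => (offMatrix col F ^ (2 * l)) i i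

/-- The generating function of the excursions from `i`, that is of the closed walks at `i` which
return to `i` only at their end. -/
def excursionSeries (col : Fin N → Bool) (F : Finset (Fin N)) (i : Fin N) :
    PowerSeries (MvPolynomial (Sym2 (Fin N)) ℕ) :=
  PowerSeries.X * PowerSeries.mk fun l => ∑ j, ∑ k, offMatrix col F i j *
    (offMatrix col (insert i F) ^ (2 * l)) j k * offMatrix col F i k

/-- The excursions from `i` which leave and come back along the same edge `s(i, j)`. -/
def branchSeries (col : Fin N → Bool) (F : Finset (Fin N)) (i j : Fin N) :
    PowerSeries (MvPolynomial (Sym2 (Fin N)) ℕ) :=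
  PowerSeries.C (offMatrix col F i j ^ 2) * PowerSeries.X * closedSeries col (insert i F) j

/-- The excursions from `i` which leave and come back along different edges. -/
def cycleSeries (col : Fin N → Bool) (F : Finset (Fin N)) (i : Fin N) :
    PowerSeries (MvPolynomial (Sym2 (Fin N)) ℕ) :=
  PowerSeries.X * PowerSeries.mk fun l => ∑ j, ∑ k, if k = j then 0 else offMatrix col F i j *
    (offMatrix col (insert i F) ^ (2 * l)) j k * offMatrix col F i k

variable (col : Fin N → Bool) (F : Finset (Fin N)) (i : Fin N)

theorem walkMatrix_comm {adj : Fin N → Fin N → Prop} (h : ∀ x y, adj x y → adj y x)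
    (x y : Fin N) : walkMatrix adj x y = walkMatrix adj y x := by
  by_cases hxy : adj x y
  · rw [walkMatrix_of_adj hxy, walkMatrix_of_adj (h _ _ hxy), Sym2.eq_swap]
  · rw [walkMatrix_of_not_adj hxy, walkMatrix_of_not_adj fun hyx => hxy (h _ _ hyx)]

theorem offAdj_symm (x y : Fin N) (h : offAdj col F x y) : offAdj col F y x :=
  ⟨h.2.1, h.1, h.2.2.symm⟩

theorem offMatrix_insert (x y : Fin N) :
    offMatrix col (insert i F) x y = if x = i ∨ y = i then 0 else offMatrix col F x y := by
  split_ifs with h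
  · refine walkMatrix_of_not_adj fun h' => ?_
    rcases h with rfl | rfl
    · exact h'.1 (Finset.mem_insert_self _ _)
    · exact h'.2.1 (Finset.mem_insert_self _ _)
  · push Not at h
    have : offAdj col (insert i F) x y ↔ offAdj col F x y := by
      simp [offAdj, h.1, h.2]
    by_cases h' : offAdj col F x y
    · rw [offMatrix, offMatrix, walkMatrix_of_adj h', walkMatrix_of_adj (this.2 h')]
    · rw [offMatrix, offMatrix, walkMatrix_of_not_adj h',
        walkMatrix_of_not_adj fun h'' => h' (this.1 h'')]

theorem offMatrix_self : offMatrix col F i i = 0 :=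
  walkMatrix_of_not_adj fun h => h.2.2 rfl

/-- A walk changes its colour at each step. -/
theorem offMatrix_pow_eq_zero (n : ℕ) (x y : Fin N) (h : ¬(Even n ↔ col x = col y)) :
    (offMatrix col F ^ n) x y = 0 := by
  induction n generalizing x with
  | zero =>
    have : x ≠ y := by rintro rfl; simp at h
    simp [this]
  | succ n ih =>
    rw [pow_succ', Matrix.mul_apply]
    refine Finset.sum_eq_zero fun k _ => ?_
    by_cases hk : offAdj col F x k
    · rw [ih k, mul_zero]
      intro h2
      apply h
      rw [Nat.even_add_one, h2]
      have := hk.2.2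
      revert this
      cases col x <;> cases col k <;> cases col y <;> simp
    · rw [offMatrix, walkMatrix_of_not_adj hk, zero_mul]

theorem offMatrix_pow_odd (n : ℕ) : (offMatrix col F ^ (2 * n + 1)) i i = 0 :=
  offMatrix_pow_eq_zero col F _ _ _ (by simp)

theorem closedSeries_eq :
    closedSeries col F i = 1 + excursionSeries col F i * closedSeries col F i := by
  ext l : 1
  cases l with
  | zero => simp [closedSeries, excursionSeries]
  | succ l =>
    rw [map_add, PowerSeries.coeff_one, if_neg (by omega), zero_add, excursionSeries, mul_assoc,
      PowerSeries.coeff_succ_X_mul, PowerSeries.coeff_mul, closedSeries, PowerSeries.coeff_mk,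
      show 2 * (l + 1) = (2 * l + 1) + 1 by ring,
      pow_succ_apply_self_eq_sum _ _ i (offMatrix_insert col F i) (offMatrix_self col F i),
      sum_range_two_mul_add_one, Finset.Nat.sum_antidiagonal_eq_sum_range_succ_mk,
      ← Finset.sum_range_reflect]
    · refine Finset.sum_congr rfl fun w hw => ?_
      have := Finset.mem_range.1 hw
      simp only [PowerSeries.coeff_mk]
      rw [show 2 * l + 1 - 1 - 2 * (l + 1 - 1 - w) = 2 * w by omega,
        show l + 1 - 1 - w = l - w by omega]
      congr 1
      refine Finset.sum_congr rfl fun x _ => Finset.sum_congr rfl fun z _ => ?_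
      rw [offMatrix, walkMatrix_comm (offAdj_symm col F) z i]
    · intro n
      rw [offMatrix_pow_odd, mul_zero]

theorem X_dvd_excursionSeries : PowerSeries.X ∣ excursionSeries col F i := Dvd.intro _ rfl

theorem branchSeries_eq_mk (j : Fin N) : branchSeries col F i j =
    PowerSeries.X * PowerSeries.mk fun l => offMatrix col F i j *
      (offMatrix col (insert i F) ^ (2 * l)) j j * offMatrix col F i j := by
  rw [branchSeries, mul_comm (PowerSeries.C _), mul_assoc]
  congr 1
  ext l : 1
  rw [PowerSeries.coeff_C_mul, closedSeries, PowerSeries.coeff_mk, PowerSeries.coeff_mk]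
  ring

theorem excursionSeries_eq :
    excursionSeries col F i = ∑ j, branchSeries col F i j + cycleSeries col F i := by
  simp only [branchSeries_eq_mk]
  rw [excursionSeries, cycleSeries, ← Finset.mul_sum, ← mul_add]
  congr 1
  ext l : 1
  rw [map_add, map_sum]
  simp only [PowerSeries.coeff_mk]
  rw [← Finset.sum_add_distrib]
  refine Finset.sum_congr rfl fun j _ => ?_
  rw [← Finset.add_sum_erase _ _ (Finset.mem_univ j),
    ← Finset.add_sum_erase Finset.univ (fun k => if k = j then 0 else _) (Finset.mem_univ j),
    if_pos rfl, zero_add]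
  congr 1
  exact Finset.sum_congr rfl fun k hk => by rw [if_neg (Finset.ne_of_mem_erase hk)]

/-- The excursions from `i` which neither leave nor come back along `s(i, j)`, and which do not
close a cycle at `i`. -/
def otherBranches (j : Fin N) : PowerSeries (MvPolynomial (Sym2 (Fin N)) ℕ) :=
  ∑ k ∈ Finset.univ.erase j, branchSeries col F i k

theorem excursionSeries_eq_otherBranches_add (j : Fin N) :
    excursionSeries col F i =
      otherBranches col F i j + (branchSeries col F i j + cycleSeries col F i) := by
  rw [excursionSeries_eq, ← Finset.add_sum_erase _ _ (Finset.mem_univ j), otherBranches]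
  ring

theorem coeff_excursionSeries_pow_dom (l v : ℕ) :
    Dom (PowerSeries.coeff l (excursionSeries col F i ^ v))
      ((offMatrix col F ^ (2 * l)) i i) := by
  have := (dom_pow_of_eq (closedSeries_eq col F i) v).coeff l
  rwa [closedSeries, PowerSeries.coeff_mk] at this

theorem coeff_otherBranches_pow_dom (j : Fin N) (l v : ℕ) :
    Dom (PowerSeries.coeff l (otherBranches col F i j ^ v))
      ((offMatrix col F ^ (2 * l)) i i) :=
  (Dom.coeff (Dom.pow ⟨_, excursionSeries_eq_otherBranches_add col F i j⟩ v) l).trans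
    (coeff_excursionSeries_pow_dom col F i l v)

theorem offMatrix_pow_dom {F' : Finset (Fin N)} (h : F' ⊆ F) (n : ℕ) (x y : Fin N) :
    Dom ((offMatrix col F ^ n) x y) ((offMatrix col F' ^ n) x y) := by
  induction n generalizing x with
  | zero => exact Dom.refl _
  | succ n ih =>
    rw [pow_succ', pow_succ', Matrix.mul_apply, Matrix.mul_apply]
    refine Dom.sum fun k _ => Dom.mul ?_ (ih k)
    by_cases hk : offAdj col F x k
    · have hk' : offAdj col F' x k := ⟨fun hx => hk.1 (h hx), fun hx => hk.2.1 (h hx), hk.2.2⟩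
      rw [offMatrix, offMatrix, walkMatrix_of_adj hk, walkMatrix_of_adj hk']
      exact Dom.refl _
    · rw [offMatrix, walkMatrix_of_not_adj hk]
      exact Dom.zero_left _

/-- The branches at `i`, sorted by the first edge `s(i, j)` and by the number `f + 1` of times
that it is used for departures. -/
theorem coeff_sum_branchSeries_pow (l r : ℕ) (h : r + 1 ≤ l) :
    PowerSeries.coeff l ((∑ j, branchSeries col F i j) ^ (r + 1)) =
      ∑ j, ∑ f ∈ Finset.range (r + 1),
        (r.choose f : MvPolynomial (Sym2 (Fin N)) ℕ) *
          ∑ x ∈ Finset.HasAntidiagonal.antidiagonal (l - (f + 1)), ∑ v ∈ Finset.range (x.1 + 1),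
            ((f + v).choose f : MvPolynomial (Sym2 (Fin N)) ℕ) *
              (offMatrix col F i j ^ (2 * (f + 1)) *
                (PowerSeries.coeff x.1 (excursionSeries col (insert i F) j ^ v) *
                  PowerSeries.coeff x.2 (otherBranches col F i j ^ (r - f)))) := by
  rw [sum_pow_succ_eq, map_sum]
  refine Finset.sum_congr rfl fun j _ => ?_
  rw [map_sum]
  refine Finset.sum_congr rfl fun f hf => ?_
  have hf' := Finset.mem_range.1 hf
  rw [← nsmul_eq_mul, ← nsmul_eq_mul, map_nsmul]
  congr 1
  rw [branchSeries, mul_pow, mul_pow, ← map_pow, mul_assoc, mul_assoc, PowerSeries.coeff_C_mul]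
  obtain ⟨l', rfl⟩ : ∃ l', l = l' + (f + 1) := ⟨l - (f + 1), by omega⟩
  rw [PowerSeries.coeff_X_pow_mul, PowerSeries.coeff_mul, Nat.add_sub_cancel, Finset.mul_sum]
  refine Finset.sum_congr rfl fun x _ => ?_
  rw [coeff_pow_succ_eq_sum_choose (X_dvd_excursionSeries col (insert i F) j)
    (closedSeries_eq col (insert i F) j), Finset.sum_mul, Finset.mul_sum]
  refine Finset.sum_congr rfl fun v _ => ?_
  rw [otherBranches, ← pow_mul]
  ring

/-! The edge `s(i, j)` is used neither beyond `j` nor by the other branches at `i`. -/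

theorem offMatrix_mem_supported {s : Set (Sym2 (Fin N))}
    (h : ∀ x y, offAdj col F x y → s(x, y) ∈ s) (x y : Fin N) :
    offMatrix col F x y ∈ (MvPolynomial.supported ℕ s).toSubsemiring := by
  by_cases hxy : offAdj col F x y
  · rw [offMatrix, walkMatrix_of_adj hxy]
    exact MvPolynomial.X_mem_supported.2 (h x y hxy)
  · rw [offMatrix, walkMatrix_of_not_adj hxy]
    exact Subsemiring.zero_mem _

theorem ne_of_offAdj_insert (j x y : Fin N) (h : offAdj col (insert i F) x y) :
    s(x, y) ∈ {e : Sym2 (Fin N) | e ≠ s(i, j)} := by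
  intro he
  have : i ∈ s(x, y) := he ▸ Sym2.mem_mk_left i j
  rcases Sym2.mem_iff.1 this with rfl | rfl
  · exact h.1 (Finset.mem_insert_self _ _)
  · exact h.2.1 (Finset.mem_insert_self _ _)

theorem excursionSeries_mem_seriesIn (S : Subsemiring (MvPolynomial (Sym2 (Fin N)) ℕ))
    (h : ∀ x y, offMatrix col F x y ∈ S) : excursionSeries col F i ∈ seriesIn S := by
  refine Subsemiring.mul_mem _ (X_mem_seriesIn S) fun l => ?_
  rw [PowerSeries.coeff_mk]
  refine S.sum_mem fun j _ => S.sum_mem fun k _ => S.mul_mem (S.mul_mem (h _ _) ?_) (h _ _)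
  refine pow_apply_mem S (fun x y => ?_) _ _ _
  rw [offMatrix_insert]
  split_ifs
  exacts [S.zero_mem, h _ _]

theorem coeff_excursionSeries_pow_mem (j : Fin N) (v u : ℕ) :
    PowerSeries.coeff u (excursionSeries col (insert i F) j ^ v) ∈
      (MvPolynomial.supported ℕ {e : Sym2 (Fin N) | e ≠ s(i, j)}).toSubsemiring :=
  Subsemiring.pow_mem _ (excursionSeries_mem_seriesIn col (insert i F) j _
    (offMatrix_mem_supported col _ (ne_of_offAdj_insert col F i j))) v u

theorem coeff_otherBranches_pow_mem (j : Fin N) (n w : ℕ) :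
    PowerSeries.coeff w (otherBranches col F i j ^ n) ∈
      (MvPolynomial.supported ℕ {e : Sym2 (Fin N) | e ≠ s(i, j)}).toSubsemiring := by
  set S := (MvPolynomial.supported ℕ {e : Sym2 (Fin N) | e ≠ s(i, j)}).toSubsemiring
  refine Subsemiring.pow_mem (seriesIn S) (Subsemiring.sum_mem _ fun k hk => ?_) n w
  have hkj := Finset.ne_of_mem_erase hk
  refine Subsemiring.mul_mem _ (Subsemiring.mul_mem _ (C_mem_seriesIn S ?_) (X_mem_seriesIn S)) ?_
  · refine S.pow_mem ?_ 2
    by_cases h : offAdj col F i k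
    · rw [offMatrix, walkMatrix_of_adj h]
      refine MvPolynomial.X_mem_supported.2 fun he => hkj ?_
      rwa [Sym2.congr_right] at he
    · rw [offMatrix, walkMatrix_of_not_adj h]
      exact S.zero_mem
  · intro l
    rw [closedSeries, PowerSeries.coeff_mk]
    exact pow_apply_mem S (offMatrix_mem_supported col _ (ne_of_offAdj_insert col F i j)) _ _ _

/-! Homogeneity of walk enumerators. -/

theorem isHomogeneous_walkMatrix (adj : Fin N → Fin N → Prop) (x y : Fin N) :
    (walkMatrix adj x y).IsHomogeneous 1 := by
  by_cases h : adj x y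
  · rw [walkMatrix_of_adj h]
    exact MvPolynomial.isHomogeneous_X _ _
  · rw [walkMatrix_of_not_adj h]
    exact MvPolynomial.isHomogeneous_zero _ _ _

theorem isHomogeneous_walkMatrix_pow (adj : Fin N → Fin N → Prop) (n : ℕ) (x y : Fin N) :
    ((walkMatrix adj ^ n) x y).IsHomogeneous n := by
  induction n generalizing x with
  | zero =>
    rw [pow_zero, Matrix.one_apply]
    split_ifs
    exacts [MvPolynomial.isHomogeneous_one _ _, MvPolynomial.isHomogeneous_zero _ _ _]
  | succ n ih =>
    rw [pow_succ', Matrix.mul_apply]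
    refine MvPolynomial.IsHomogeneous.sum _ _ _ fun k _ => ?_
    rw [add_comm n 1]
    exact (isHomogeneous_walkMatrix adj x k).mul (ih k)

end Series

section Expectation

/-! ### The expectation functional -/

section EdgeMoment

variable {σ : Type*} [DecidableEq σ] {p : ℝ} {X : ℕ → ℝ} {N : ℕ}

/-- The expectation of the monomial with exponent vector `m` in independent variables `a_e d_e`,
where `a_e` has the moments `X` and `d_e` is a Bernoulli variable of parameter `p / N`. -/
def edgeMoment (p : ℝ) (X : ℕ → ℝ) (N : ℕ) (m : σ →₀ ℕ) : ℝ :=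
  ∏ e ∈ m.support, (p / N * X (m e))

theorem edgeMoment_add (m m' : σ →₀ ℕ) (h : Disjoint m.support m'.support) :
    edgeMoment p X N (m + m') = edgeMoment p X N m * edgeMoment p X N m' := by
  unfold edgeMoment
  rw [Finsupp.support_add_eq_union, Finset.prod_union h]
  congr 1
  · refine Finset.prod_congr rfl fun e he => ?_
    have : m' e = 0 := by
      rw [← Finsupp.notMem_support_iff]
      exact Finset.disjoint_left.1 h he
    rw [Finsupp.add_apply, this, add_zero]
  · refine Finset.prod_congr rfl fun e he => ?_
    have : m e = 0 := by
      rw [← Finsupp.notMem_support_iff]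
      exact Finset.disjoint_right.1 h he
    rw [Finsupp.add_apply, this, zero_add]

/-- A constant which controls the moments of all monomials of degree at most `n`. -/
def momentBound (p : ℝ) (X : ℕ → ℝ) (n : ℕ) : ℝ :=
  (1 + ∑ k ∈ Finset.range (n + 1), |p * X k|) ^ n

theorem momentBound_nonneg (p : ℝ) (X : ℕ → ℝ) (n : ℕ) : 0 ≤ momentBound p X n := by
  unfold momentBound
  have : 0 ≤ ∑ k ∈ Finset.range (n + 1), |p * X k| := Finset.sum_nonneg fun _ _ => abs_nonneg _
  positivity

theorem abs_edgeMoment_le (p : ℝ) (X : ℕ → ℝ) {n : ℕ} {m : σ →₀ ℕ} (hm : m.degree = n) :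
    |edgeMoment p X N m| ≤ momentBound p X n * edgeWeight N ∅ m := by
  set B : ℝ := 1 + ∑ k ∈ Finset.range (n + 1), |p * X k| with hB
  have hs : 0 ≤ ∑ k ∈ Finset.range (n + 1), |p * X k| := Finset.sum_nonneg fun _ _ => abs_nonneg _
  have hB1 : 1 ≤ B := by linarith
  have hB0 : 0 ≤ B := by linarith
  have h1 : |edgeMoment p X N m| ≤ ∏ _e ∈ m.support, (B * (N : ℝ)⁻¹) := by
    rw [edgeMoment, Finset.abs_prod]
    refine Finset.prod_le_prod (fun _ _ => abs_nonneg _) fun e _ => ?_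
    have h2 : m e ∈ Finset.range (n + 1) :=
      Finset.mem_range.2 (Nat.lt_succ_of_le (hm ▸ Finsupp.le_degree e m))
    have h3 : |p * X (m e)| ≤ B :=
      (Finset.single_le_sum (f := fun k => |p * X k|) (fun _ _ => abs_nonneg _) h2).trans
        (by linarith)
    rw [show p / N * X (m e) = (p * X (m e)) * (N : ℝ)⁻¹ by ring, abs_mul,
      abs_of_nonneg (a := (N : ℝ)⁻¹) (by positivity)]
    gcongr
  have hcard : m.support.card ≤ n := by
    rw [← hm, Finsupp.degree_apply, Finset.card_eq_sum_ones]
    exact Finset.sum_le_sum fun e he => Nat.one_le_iff_ne_zero.2 (Finsupp.mem_support_iff.1 he)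
  rw [Finset.prod_const, mul_pow] at h1
  refine h1.trans ?_
  rw [momentBound, ← hB, edgeWeight, Finset.sdiff_empty]
  gcongr

/-- The expectation of a polynomial in the edge variables. -/
abbrev expect (p : ℝ) (X : ℕ → ℝ) (N : ℕ) : MvPolynomial σ ℕ →ₗ[ℕ] ℝ :=
  functional (edgeMoment p X N)

theorem expect_one {τ : Type*} : expect (σ := τ) p X N 1 = 1 := by
  rw [functional_one]
  simp [edgeMoment]

theorem abs_expect_le {P Q : MvPolynomial σ ℕ} {n : ℕ} (h : Dom P Q) (hQ : Q.IsHomogeneous n) :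
    |expect p X N P| ≤ momentBound p X n * functional (edgeWeight N ∅) Q := by
  rw [← functional_const_mul]
  refine (abs_functional_le _ _).trans ((functional_mono fun m hm =>
    abs_edgeMoment_le p X (degree_of_dom h hQ hm)).trans (functional_le_of_dom (fun m => ?_) h))
  exact mul_nonneg (momentBound_nonneg p X n) (edgeWeight_nonneg _ _ _)

theorem expect_X_pow_mul {e : σ} {n : ℕ} (hn : n ≠ 0) {P : MvPolynomial σ ℕ}
    (hP : P ∈ (MvPolynomial.supported ℕ {e' : σ | e' ≠ e}).toSubsemiring) :
    expect p X N (MvPolynomial.X e ^ n * P) = p / N * X n * expect p X N P := by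
  rw [expect, functional_mul, MvPolynomial.X_pow_eq_monomial, functional_monomial_one,
    ← functional_const_mul]
  refine functional_congr fun m hm => ?_
  have he : e ∉ m.support := by
    intro he
    have h1 : e ∈ P.vars := (MvPolynomial.mem_vars_iff_mem_support _).2 ⟨m, hm, he⟩
    exact (MvPolynomial.mem_supported.1 hP) h1 rfl
  rw [edgeMoment_add]
  · congr 1
    rw [edgeMoment, Finsupp.support_single _ hn, Finset.prod_singleton, Finsupp.single_eq_same]
  · rw [Finsupp.support_single _ hn]
    exact Finset.disjoint_singleton_left.2 he

end EdgeMoment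

variable {p : ℝ} {X : ℕ → ℝ}

/-- Only pairs of monomials with a common edge contribute to the covariance of two polynomials. -/
theorem abs_covariance_le {N : ℕ} (hN : 1 ≤ N) {P P' Q Q' : MvPolynomial (Sym2 (Fin N)) ℕ}
    {a b : ℕ} (hP : Dom P P') (hQ : Dom Q Q') (hP' : P'.IsHomogeneous a)
    (hQ' : Q'.IsHomogeneous b) :
    |expect p X N (P * Q) - expect p X N P * expect p X N Q| ≤
      (momentBound p X (a + b) + momentBound p X a * momentBound p X b) *
        functional (fun m => edgeWeight N ∅ m *
          functional (hitWeight N m.support m.support) Q') P' := by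
  set c := momentBound p X (a + b) + momentBound p X a * momentBound p X b with hc
  have ha := momentBound_nonneg p X a
  have hb := momentBound_nonneg p X b
  have hab := momentBound_nonneg p X (a + b)
  have hc0 : 0 ≤ c := by positivity
  have hker : ∀ m ∈ P.support, ∀ m' ∈ Q.support,
      |edgeMoment p X N (m + m') - edgeMoment p X N m * edgeMoment p X N m'| ≤
        c * edgeWeight N ∅ m * hitWeight N m.support m.support m' := by
    intro m hm m' hm'
    by_cases hd : Disjoint m.support m'.support
    · rw [edgeMoment_add m m' hd, sub_self, abs_zero]
      exact mul_nonneg (mul_nonneg hc0 (edgeWeight_nonneg _ _ _)) (hitWeight_nonneg _ _ _)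
    · have hdm := degree_of_dom hP hP' hm
      have hdm' := degree_of_dom hQ hQ' hm'
      have h1 := abs_edgeMoment_le (N := N) p X (show (m + m').degree = a + b by
        rw [map_add, hdm, hdm'])
      have h2 := abs_edgeMoment_le (N := N) p X hdm
      have h3 := abs_edgeMoment_le (N := N) p X hdm'
      have e1 := edgeWeight_add N ∅ m m'
      rw [Finset.empty_union] at e1
      rw [hitWeight, if_neg fun h => hd h.symm, mul_one]
      have w1 := edgeWeight_nonneg N ∅ m
      have w2 := edgeWeight_nonneg N m.support m'
      have w3 := edgeWeight_anti hN (Finset.empty_subset m.support) m'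
      refine (abs_sub _ _).trans ?_
      rw [abs_mul]
      calc _ ≤ momentBound p X (a + b) * edgeWeight N ∅ (m + m') +
            (momentBound p X a * edgeWeight N ∅ m) * (momentBound p X b * edgeWeight N ∅ m') := by
            gcongr
        _ ≤ momentBound p X (a + b) * (edgeWeight N ∅ m * edgeWeight N m.support m') +
            (momentBound p X a * edgeWeight N ∅ m) *
              (momentBound p X b * edgeWeight N m.support m') := by
            rw [e1]; gcongr
        _ = _ := by rw [hc]; ring
  rw [expect, functional_mul, functional_mul_functional, ← functional_sub]
  refine (abs_functional_le _ _).trans ?_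
  rw [← functional_const_mul]
  refine (functional_mono (h := fun m => c * (edgeWeight N ∅ m *
    functional (hitWeight N m.support m.support) Q')) fun m hm => ?_).trans
      (functional_le_of_dom (fun m => ?_) hP)
  · rw [← functional_sub]
    refine (abs_functional_le _ _).trans ((functional_mono fun m' hm' => hker m hm m' hm').trans ?_)
    rw [functional_const_mul, mul_assoc]
    have := functional_le_of_dom (hitWeight_nonneg m.support m.support) hQ
    have w1 := edgeWeight_nonneg N ∅ m
    gcongr
  · exact mul_nonneg hc0 (mul_nonneg (edgeWeight_nonneg _ _ _)
      (functional_nonneg (hitWeight_nonneg _ _) _))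

/-- Closed walks at two different vertices are uncorrelated up to `O(1 / N)`. -/
theorem covariance_closedWalk_le (p : ℝ) (X : ℕ → ℝ) (a b : ℕ) : ∃ c : ℝ, 0 ≤ c ∧
    ∀ (N : ℕ), 1 ≤ N →
    ∀ (adj : Fin N → Fin N → Prop) (i j : Fin N), i ≠ j →
    ∀ P Q, Dom P ((walkMatrix adj ^ a) i i) → Dom Q ((walkMatrix adj ^ b) j j) →
    |expect p X N (P * Q) - expect p X N P * expect p X N Q| ≤ c * (N : ℝ)⁻¹ := by
  obtain ⟨c, hc, h⟩ := walk_pair_hit_le a b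
  have ha := momentBound_nonneg p X a
  have hb := momentBound_nonneg p X b
  have hab := momentBound_nonneg p X (a + b)
  refine ⟨(momentBound p X (a + b) + momentBound p X a * momentBound p X b) * c, by positivity, ?_⟩
  intro N hN adj i j hij P Q hP hQ
  have hhom : ∀ (n : ℕ) (x : Fin N), (∑ y, (walkMatrix adj ^ n) x y).IsHomogeneous n :=
    fun n x => MvPolynomial.IsHomogeneous.sum _ _ _ fun y _ =>
      isHomogeneous_walkMatrix_pow adj n x y
  have h1 := abs_covariance_le (p := p) (X := X) hN (hP.trans (dom_walk_sum adj a i))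
    (hQ.trans (dom_walk_sum adj b j)) (hhom a i) (hhom b j)
  refine h1.trans ?_
  rw [mul_assoc]
  gcongr
  exact h N hN adj i j hij

theorem abs_expect_closedWalk_le (p : ℝ) (X : ℕ → ℝ) (a b : ℕ) : ∃ c : ℝ, 0 ≤ c ∧
    ∀ (N : ℕ), 1 ≤ N → ∀ (adj : Fin N → Fin N → Prop) (i : Fin N) (P : MvPolynomial _ ℕ),
    Dom P ((walkMatrix adj ^ a) i i * (walkMatrix adj ^ b) i i) →
    |expect p X N P| ≤ c := by
  have hab := momentBound_nonneg p X (a + b)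
  refine ⟨momentBound p X (a + b) *
    ((2 * ((1 + a + b : ℕ) : ℝ) + 1) ^ a * (2 * ((1 + a + b : ℕ) : ℝ) + 1) ^ b), by positivity, ?_⟩
  intro N hN adj i P hP
  refine (abs_expect_le hP ((isHomogeneous_walkMatrix_pow adj a i i).mul
    (isHomogeneous_walkMatrix_pow adj b i i))).trans ?_
  gcongr
  exact closedWalk_mul_closedWalk_le hN adj (1 + a + b) a b {i} ∅ i i
    (fun e he => by simp at he) (by simp) (by simp) (by simp)

/-! ### Negligible excursions -/

theorem functional_cycleSeries_le (l : ℕ) : ∃ c : ℝ, 0 ≤ c ∧ ∀ (N : ℕ), 1 ≤ N →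
    ∀ (col : Fin N → Bool) (F : Finset (Fin N)) (i : Fin N),
    functional (edgeWeight N ∅) (PowerSeries.coeff l (cycleSeries col F i * closedSeries col F i)) ≤
      c * (N : ℝ)⁻¹ := by
  cases l with
  | zero =>
    refine ⟨0, le_rfl, fun N hN col F i => ?_⟩
    simp [cycleSeries]
  | succ l =>
    choose c hc h using cycle_le
    refine ⟨∑ x ∈ Finset.HasAntidiagonal.antidiagonal l, c (2 * x.1) (2 * x.2),
      Finset.sum_nonneg fun x _ => hc _ _, fun N hN col F i => ?_⟩
    rw [cycleSeries, mul_assoc, PowerSeries.coeff_succ_X_mul, PowerSeries.coeff_mul, map_sum,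
      Finset.sum_mul]
    refine Finset.sum_le_sum fun x _ => ?_
    have := h (2 * x.1) (2 * x.2) N hN (offAdj col F) (offAdj col (insert i F)) i
      (fun y z hyz => ⟨fun e => hyz.1 (e ▸ Finset.mem_insert_self _ _),
        fun e => hyz.2.1 (e ▸ Finset.mem_insert_self _ _)⟩) (fun h => h.2.2 rfl)
    refine le_of_eq_of_le (congrArg _ ?_) this
    rw [closedSeries, PowerSeries.coeff_mk, PowerSeries.coeff_mk, Finset.sum_mul]
    refine Finset.sum_congr rfl fun j _ => ?_
    rw [Finset.sum_mul, Finset.mul_sum]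
    refine Finset.sum_congr rfl fun k _ => ?_
    split_ifs
    · simp
    · ring

theorem functional_branchSeries_le (l : ℕ) : ∃ c : ℝ, 0 ≤ c ∧ ∀ (N : ℕ), 1 ≤ N →
    ∀ (col : Fin N → Bool) (F : Finset (Fin N)) (i j : Fin N),
    functional (edgeWeight N ∅)
      (PowerSeries.coeff l (branchSeries col F i j * closedSeries col F i)) ≤ c * (N : ℝ)⁻¹ := by
  cases l with
  | zero =>
    refine ⟨0, le_rfl, fun N hN col F i j => ?_⟩
    simp [branchSeries_eq_mk]
  | succ l =>
    choose c hc h using pinned_le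
    refine ⟨∑ x ∈ Finset.HasAntidiagonal.antidiagonal l, c (2 * x.1) (2 * x.2),
      Finset.sum_nonneg fun x _ => hc _ _, fun N hN col F i j => ?_⟩
    rw [branchSeries_eq_mk, mul_assoc, PowerSeries.coeff_succ_X_mul, PowerSeries.coeff_mul, map_sum,
      Finset.sum_mul]
    refine Finset.sum_le_sum fun x _ => ?_
    refine (functional_le_of_dom (edgeWeight_nonneg N ∅) ?_).trans
      (h (2 * x.1) (2 * x.2) N hN (offAdj col F) i j)
    rw [closedSeries, PowerSeries.coeff_mk, PowerSeries.coeff_mk, mul_right_comm (offMatrix col F i j), ← sq]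
    exact ((Dom.refl _).mul
      (offMatrix_pow_dom col _ (Finset.subset_insert i F) _ _ _)).mul (Dom.refl _)

/-- Power series whose coefficient of index `l` is homogeneous of degree `2 l`. -/
def IsGraded {σ : Type*} (a : PowerSeries (MvPolynomial σ ℕ)) : Prop :=
  ∀ l, (PowerSeries.coeff l a).IsHomogeneous (2 * l)

theorem IsGraded.add {σ : Type*} {a b : PowerSeries (MvPolynomial σ ℕ)} (ha : IsGraded a)
    (hb : IsGraded b) : IsGraded (a + b) := fun l => by
  rw [map_add]
  exact (ha l).add (hb l)

theorem IsGraded.mul {σ : Type*} {a b : PowerSeries (MvPolynomial σ ℕ)} (ha : IsGraded a)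
    (hb : IsGraded b) : IsGraded (a * b) := fun l => by
  rw [PowerSeries.coeff_mul]
  refine MvPolynomial.IsHomogeneous.sum _ _ _ fun x hx => ?_
  rw [← Finset.HasAntidiagonal.mem_antidiagonal.1 hx, mul_add]
  exact (ha _).mul (hb _)

theorem isGraded_X_mul_mk {σ : Type*} {f : ℕ → MvPolynomial σ ℕ}
    (h : ∀ l, (f l).IsHomogeneous (1 + 2 * l + 1)) :
    IsGraded (PowerSeries.X * PowerSeries.mk f) := fun l => by
  cases l with
  | zero =>
    rw [PowerSeries.coeff_zero_X_mul]
    exact MvPolynomial.isHomogeneous_zero _ _ _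
  | succ l =>
    rw [PowerSeries.coeff_succ_X_mul, PowerSeries.coeff_mk, show 2 * (l + 1) = 1 + 2 * l + 1 by ring]
    exact h l

theorem isGraded_closedSeries {N : ℕ} (col : Fin N → Bool) (F : Finset (Fin N)) (i : Fin N) :
    IsGraded (closedSeries col F i) := fun l => by
  rw [closedSeries, PowerSeries.coeff_mk]
  exact isHomogeneous_walkMatrix_pow _ _ _ _

theorem isGraded_branchSeries {N : ℕ} (col : Fin N → Bool) (F : Finset (Fin N)) (i j : Fin N) :
    IsGraded (branchSeries col F i j) := by
  rw [branchSeries_eq_mk]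
  exact isGraded_X_mul_mk fun l => ((isHomogeneous_walkMatrix _ _ _).mul
    (isHomogeneous_walkMatrix_pow _ _ _ _)).mul (isHomogeneous_walkMatrix _ _ _)

theorem isGraded_cycleSeries {N : ℕ} (col : Fin N → Bool) (F : Finset (Fin N)) (i : Fin N) :
    IsGraded (cycleSeries col F i) := by
  refine isGraded_X_mul_mk fun l => MvPolynomial.IsHomogeneous.sum _ _ _ fun j _ =>
    MvPolynomial.IsHomogeneous.sum _ _ _ fun k _ => ?_
  split_ifs
  · exact MvPolynomial.isHomogeneous_zero _ _ _
  · exact ((isHomogeneous_walkMatrix _ _ _).mul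
      (isHomogeneous_walkMatrix_pow _ _ _ _)).mul (isHomogeneous_walkMatrix _ _ _)

/-- Discarding a graded part `O` of the excursions, when `O` has small weight. -/
theorem abs_expect_pow_sub_le {N : ℕ} {col : Fin N → Bool} {F : Finset (Fin N)} {i : Fin N}
    {D O : PowerSeries (MvPolynomial (Sym2 (Fin N)) ℕ)} (hE : excursionSeries col F i = D + O)
    (hO : IsGraded O) {l : ℕ} {c : ℝ}
    (h : functional (edgeWeight N ∅) (PowerSeries.coeff l (O * closedSeries col F i)) ≤ c)
    (r : ℕ) :
    |expect p X N (PowerSeries.coeff l (excursionSeries col F i ^ r)) -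
      expect p X N (PowerSeries.coeff l (D ^ r))| ≤ momentBound p X (2 * l) * (r * c) := by
  obtain ⟨K, hK, hd⟩ := exists_pow_eq_add (closedSeries_eq col F i) hE r
  rw [hK, map_add, map_add, add_sub_cancel_left]
  have h1 : Dom (PowerSeries.coeff l (O * K))
      (PowerSeries.coeff l (r • (O * closedSeries col F i))) := by
    refine Dom.coeff ?_ l
    rw [nsmul_eq_mul, mul_left_comm]
    exact (Dom.refl O).mul hd
  rw [map_nsmul] at h1
  have h2 : (r • PowerSeries.coeff l (O * closedSeries col F i)).IsHomogeneous (2 * l) := by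
    rw [← Finset.card_range r, ← Finset.sum_const]
    exact MvPolynomial.IsHomogeneous.sum _ _ _ fun _ _ => hO.mul (isGraded_closedSeries col F i) l
  refine (abs_expect_le h1 h2).trans ?_
  rw [map_nsmul, nsmul_eq_mul]
  have := momentBound_nonneg p X (2 * l)
  gcongr

theorem abs_expect_excursion_sub_branch_le (p : ℝ) (X : ℕ → ℝ) (l r : ℕ) : ∃ c : ℝ, 0 ≤ c ∧
    ∀ (N : ℕ), 1 ≤ N → ∀ (col : Fin N → Bool) (F : Finset (Fin N)) (i : Fin N),
    |expect p X N (PowerSeries.coeff l (excursionSeries col F i ^ r)) -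
      expect p X N (PowerSeries.coeff l ((∑ j, branchSeries col F i j) ^ r))| ≤
        c * (N : ℝ)⁻¹ := by
  obtain ⟨c, hc, h⟩ := functional_cycleSeries_le l
  have := momentBound_nonneg p X (2 * l)
  refine ⟨momentBound p X (2 * l) * (r * c), by positivity, fun N hN col F i => ?_⟩
  have := abs_expect_pow_sub_le (p := p) (X := X) (excursionSeries_eq col F i)
    (isGraded_cycleSeries col F i) (h N hN col F i) r
  linarith

theorem abs_expect_excursion_sub_otherBranches_le (p : ℝ) (X : ℕ → ℝ) (l r : ℕ) : ∃ c : ℝ, 0 ≤ c ∧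
    ∀ (N : ℕ), 1 ≤ N → ∀ (col : Fin N → Bool) (F : Finset (Fin N)) (i j : Fin N),
    |expect p X N (PowerSeries.coeff l (excursionSeries col F i ^ r)) -
      expect p X N (PowerSeries.coeff l (otherBranches col F i j ^ r))| ≤ c * (N : ℝ)⁻¹ := by
  obtain ⟨c₁, hc₁, h₁⟩ := functional_branchSeries_le l
  obtain ⟨c₂, hc₂, h₂⟩ := functional_cycleSeries_le l
  have := momentBound_nonneg p X (2 * l)
  refine ⟨momentBound p X (2 * l) * (r * (c₁ + c₂)), by positivity, fun N hN col F i j => ?_⟩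
  have := abs_expect_pow_sub_le (p := p) (X := X) (l := l) (c := (c₁ + c₂) * (N : ℝ)⁻¹)
    (excursionSeries_eq_otherBranches_add col F i j)
    ((isGraded_branchSeries col F i j).add (isGraded_cycleSeries col F i)) (by
      rw [add_mul, map_add, map_add, add_mul]
      exact add_le_add (h₁ N hN col F i j) (h₂ N hN col F i)) r
  linarith

end Expectation

section Limit

/-! ### The limiting recurrence -/

/-- The asymptotic proportion of the vertices of colour `b`. -/
def part (α : ℝ) (b : Bool) : ℝ := if b then α else 1 - α

/-- The limit of the weight of the closed walks at a given vertex of colour `b`; the factor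
`part α b` in `S` is the density of such vertices. -/
def rootedMoment (p α : ℝ) (X : ℕ → ℝ) (b : Bool) (l r : ℕ) : ℝ := S p α X b l r / part α b

/-- The two colour classes have the proportions `α` and `1 - α` up to rounding. -/
def IsBalanced (α : ℝ) {N : ℕ} (col : Fin N → Bool) : Prop :=
  ∀ b, |((Finset.univ.filter fun i => col i = b).card : ℝ) * (N : ℝ)⁻¹ - part α b| ≤ (N : ℝ)⁻¹

variable {p α : ℝ} {X : ℕ → ℝ}

theorem part_pos (hα : α ∈ Set.Ioo (0 : ℝ) 1) (b : Bool) : 0 < part α b := by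
  unfold part
  split_ifs
  · exact hα.1
  · linarith [hα.2]

theorem part_mul_rootedMoment (hα : α ∈ Set.Ioo (0 : ℝ) 1) (b : Bool) (l r : ℕ) :
    part α b * rootedMoment p α X b l r = S p α X b l r :=
  mul_div_cancel₀ _ (part_pos hα b).ne'

theorem rootedMoment_zero (hα : α ∈ Set.Ioo (0 : ℝ) 1) (b : Bool) (l : ℕ) :
    rootedMoment p α X b l 0 = if l = 0 then 1 else 0 := by
  have := (part_pos hα b).ne'
  rw [rootedMoment, S]
  split_ifs with h hb
  · subst hb; exact div_self this
  · simp only [Bool.not_eq_true] at hb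
    subst hb; exact div_self this
  · exact zero_div _

/-- The limit of the contribution of the first edge, before multiplication with its expected number
of realizations. -/
def branchLimit (p α : ℝ) (X : ℕ → ℝ) (b : Bool) (l r : ℕ) : ℝ :=
  ∑ f ∈ Finset.range (r + 1), (r.choose f : ℝ) *
    ∑ x ∈ Finset.HasAntidiagonal.antidiagonal (l - (f + 1)), ∑ v ∈ Finset.range (x.1 + 1),
      ((f + v).choose f : ℝ) * (X (2 * (f + 1)) *
        (rootedMoment p α X (!b) x.1 v * rootedMoment p α X b x.2 (r - f)))

theorem rootedMoment_succ (hα : α ∈ Set.Ioo (0 : ℝ) 1) (b : Bool) (l r : ℕ) (h : r + 1 ≤ l) :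
    rootedMoment p α X b l (r + 1) = p * (part α (!b) * branchLimit p α X b l r) := by
  have h1 := (part_pos hα b).ne'
  rw [rootedMoment, S_succ_antidiagonal _ _ _ _ _ _ h, div_eq_iff h1, branchLimit]
  rw [mul_assoc p]
  congr 1
  rw [Finset.mul_sum, Finset.sum_mul]
  refine Finset.sum_congr rfl fun f _ => ?_
  rw [Finset.mul_sum, Finset.mul_sum, Finset.mul_sum, Finset.sum_mul]
  refine Finset.sum_congr rfl fun x _ => ?_
  rw [Finset.mul_sum, Finset.mul_sum, Finset.mul_sum, Finset.mul_sum, Finset.sum_mul]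
  refine Finset.sum_congr rfl fun v _ => ?_
  rw [← part_mul_rootedMoment hα b, ← part_mul_rootedMoment hα (!b)]
  ring

/-- An `O(1 / N)` estimate for a product with two asymptotically independent factors. -/
theorem abs_sub_mul_le {e a b s t c₁ c₂ c₃ B n : ℝ} (h₁ : |e - a * b| ≤ c₁ * n)
    (h₂ : |a - s| ≤ c₂ * n) (h₃ : |b - t| ≤ c₃ * n) (hb : |b| ≤ B) :
    |e - s * t| ≤ (c₁ + c₂ * B + |s| * c₃) * n := by
  have e1 : e - s * t = (e - a * b) + ((a - s) * b + s * (b - t)) := by ring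
  have h4 : |(a - s) * b| ≤ (c₂ * n) * B := by
    rw [abs_mul]
    exact mul_le_mul h₂ hb (abs_nonneg _) ((abs_nonneg _).trans h₂)
  have h5 : |s * (b - t)| ≤ |s| * (c₃ * n) := by
    rw [abs_mul]
    exact mul_le_mul_of_nonneg_left h₃ (abs_nonneg _)
  rw [e1]
  calc _ ≤ |e - a * b| + (|(a - s) * b| + |s * (b - t)|) :=
        (abs_add_le _ _).trans (add_le_add le_rfl (abs_add_le _ _))
    _ ≤ c₁ * n + ((c₂ * n) * B + |s| * (c₃ * n)) := by gcongr
    _ = _ := by ring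

/-- Uniform estimates are stable under finite linear combinations. -/
theorem exists_abs_sum_sub_le {ι T : Type*} (A : T → Prop) (n : T → ℝ) (s : Finset ι)
    (w : ι → ℝ) (F : ι → T → ℝ) (L : ι → ℝ)
    (h : ∀ i ∈ s, ∃ c : ℝ, 0 ≤ c ∧ ∀ t, A t → |F i t - L i| ≤ c * n t) :
    ∃ c : ℝ, 0 ≤ c ∧ ∀ t, A t → |∑ i ∈ s, w i * F i t - ∑ i ∈ s, w i * L i| ≤ c * n t := by
  choose! c hc hF using h
  refine ⟨∑ i ∈ s, |w i| * c i,
    Finset.sum_nonneg fun i hi => mul_nonneg (abs_nonneg _) (hc i hi), fun t ht => ?_⟩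
  rw [← Finset.sum_sub_distrib, Finset.sum_mul]
  refine (Finset.abs_sum_le_sum_abs _ _).trans (Finset.sum_le_sum fun i hi => ?_)
  rw [← mul_sub, abs_mul, mul_assoc]
  exact mul_le_mul_of_nonneg_left (hF i hi t ht) (abs_nonneg _)

/-- Main estimate: the expected weight of the closed walks of half-length `l` at the vertex `i` with
`r` returns to `i`, avoiding a set `F` of bounded size, is `rootedMoment` up to `O(1 / N)`. -/
theorem abs_expect_excursion_sub_le (hp : 0 ≤ p) (hα : α ∈ Set.Ioo (0 : ℝ) 1) (l r K : ℕ)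
    (b : Bool) :
    ∃ c : ℝ, 0 ≤ c ∧ ∀ (N : ℕ), 1 ≤ N → ∀ (col : Fin N → Bool), IsBalanced α col →
    ∀ (F : Finset (Fin N)) (i : Fin N), F.card ≤ K → i ∉ F → col i = b →
    |expect p X N (PowerSeries.coeff l (excursionSeries col F i ^ r)) -
      rootedMoment p α X b l r| ≤ c * (N : ℝ)⁻¹ := by
  induction l using Nat.strong_induction_on generalizing r K b with
  | _ l ih =>
  cases r with
  | zero =>
    refine ⟨0, le_rfl, fun N hN col hcol F i hF hi hb => ?_⟩
    rw [pow_zero, PowerSeries.coeff_one, rootedMoment_zero hα]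
    split_ifs
    · rw [expect_one]; simp
    · rw [map_zero]; simp
  | succ r =>
  rcases Nat.lt_or_ge l (r + 1) with hlr | hlr
  · refine ⟨0, le_rfl, fun N hN col hcol F i hF hi hb => ?_⟩
    rw [coeff_pow_eq_zero (X_dvd_excursionSeries col F i) hlr, map_zero, rootedMoment,
      S_eq_zero_of_lt _ _ _ _ _ _ hlr]
    simp
  -- one term of the expansion, for a fixed neighbour `j` of `i`
  have hterm : ∀ f ∈ Finset.range (r + 1),
      ∀ x ∈ Finset.HasAntidiagonal.antidiagonal (l - (f + 1)), ∀ v : ℕ,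
      ∃ c : ℝ, 0 ≤ c ∧ ∀ (N : ℕ), 1 ≤ N → ∀ (col : Fin N → Bool), IsBalanced α col →
      ∀ (F : Finset (Fin N)) (i j : Fin N), F.card ≤ K → i ∉ F → col i = b → j ∉ F →
      col j = (!b) →
      |X (2 * (f + 1)) * expect p X N
        (PowerSeries.coeff x.1 (excursionSeries col (insert i F) j ^ v) *
          PowerSeries.coeff x.2 (otherBranches col F i j ^ (r - f))) -
        X (2 * (f + 1)) * (rootedMoment p α X (!b) x.1 v * rootedMoment p α X b x.2 (r - f))| ≤
          c * (N : ℝ)⁻¹ := by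
    intro f hf x hx v
    have hf' := Finset.mem_range.1 hf
    have hx' := Finset.HasAntidiagonal.mem_antidiagonal.1 hx
    obtain ⟨c₁, hc₁, h₁⟩ := covariance_closedWalk_le p X (2 * x.1) (2 * x.2)
    obtain ⟨c₂, hc₂, h₂⟩ := ih x.1 (by omega) v (K + 1) (!b)
    obtain ⟨c₃, hc₃, h₃⟩ := ih x.2 (by omega) (r - f) K b
    obtain ⟨c₄, hc₄, h₄⟩ := abs_expect_excursion_sub_otherBranches_le p X x.2 (r - f)
    obtain ⟨B, hB, h₅⟩ := abs_expect_closedWalk_le p X (2 * x.2) 0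
    refine ⟨|X (2 * (f + 1))| *
      (c₁ + c₂ * B + |rootedMoment p α X (!b) x.1 v| * (c₄ + c₃)), by positivity, ?_⟩
    intro N hN col hcol F i j hF hi hib hj hjb
    have hij : i ≠ j := by rintro rfl; rw [hib] at hjb; cases b <;> simp at hjb
    rw [← mul_sub, abs_mul, mul_assoc]
    refine mul_le_mul_of_nonneg_left ?_ (abs_nonneg _)
    have hP := (coeff_excursionSeries_pow_dom col (insert i F) j x.1 v).trans
      (offMatrix_pow_dom col _ (Finset.subset_insert i F) _ _ _)
    have hQ := coeff_otherBranches_pow_dom col F i j x.2 (r - f)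
    refine abs_sub_mul_le (h₁ N hN (offAdj col F) j i hij.symm _ _ hP hQ)
      (h₂ N hN col hcol (insert i F) j ((Finset.card_insert_le _ _).trans (by omega)) ?_ hjb) ?_
      (h₅ N hN (offAdj col F) i _ ?_)
    · rw [Finset.mem_insert, not_or]
      exact ⟨hij.symm, hj⟩
    · have a1 := h₄ N hN col F i j
      have a2 := h₃ N hN col hcol F i hF hi hib
      rw [abs_sub_comm] at a1
      refine (abs_sub_le _ _ _).trans ((add_le_add a1 a2).trans (le_of_eq ?_))
      ring
    · simpa using hQ
  -- the sum over all terms, for a fixed neighbour `j`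
  have hsum : ∃ c : ℝ, 0 ≤ c ∧ ∀ (N : ℕ), 1 ≤ N → ∀ (col : Fin N → Bool), IsBalanced α col →
      ∀ (F : Finset (Fin N)) (i j : Fin N), F.card ≤ K → i ∉ F → col i = b → j ∉ F →
      col j = (!b) →
      |(∑ f ∈ Finset.range (r + 1), (r.choose f : ℝ) *
        ∑ x ∈ Finset.HasAntidiagonal.antidiagonal (l - (f + 1)), ∑ v ∈ Finset.range (x.1 + 1),
          ((f + v).choose f : ℝ) * (X (2 * (f + 1)) * expect p X N
            (PowerSeries.coeff x.1 (excursionSeries col (insert i F) j ^ v) *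
              PowerSeries.coeff x.2 (otherBranches col F i j ^ (r - f))))) -
        branchLimit p α X b l r| ≤ c * (N : ℝ)⁻¹ := by
    let T := Σ N : ℕ, (Fin N → Bool) × Finset (Fin N) × Fin N × Fin N
    let A : T → Prop := fun t => 1 ≤ t.1 ∧ IsBalanced α t.2.1 ∧ t.2.2.1.card ≤ K ∧
      t.2.2.2.1 ∉ t.2.2.1 ∧ t.2.1 t.2.2.2.1 = b ∧ t.2.2.2.2 ∉ t.2.2.1 ∧
      t.2.1 t.2.2.2.2 = (!b)
    have h1 := exists_abs_sum_sub_le A (fun t => (t.1 : ℝ)⁻¹) (Finset.range (r + 1))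
      (fun f => (r.choose f : ℝ))
      (fun f t => ∑ x ∈ Finset.HasAntidiagonal.antidiagonal (l - (f + 1)), 1 *
        ∑ v ∈ Finset.range (x.1 + 1),
          ((f + v).choose f : ℝ) * (X (2 * (f + 1)) * expect p X t.1
            (PowerSeries.coeff x.1 (excursionSeries t.2.1 (insert t.2.2.2.1 t.2.2.1) t.2.2.2.2 ^ v) *
              PowerSeries.coeff x.2
                (otherBranches t.2.1 t.2.2.1 t.2.2.2.1 t.2.2.2.2 ^ (r - f)))))
      (fun f => ∑ x ∈ Finset.HasAntidiagonal.antidiagonal (l - (f + 1)), 1 *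
        ∑ v ∈ Finset.range (x.1 + 1),
          ((f + v).choose f : ℝ) * (X (2 * (f + 1)) *
            (rootedMoment p α X (!b) x.1 v * rootedMoment p α X b x.2 (r - f))))
      (fun f hf => exists_abs_sum_sub_le A _ _ (fun _ => 1) _ _
        (fun x hx => exists_abs_sum_sub_le A _ _ (fun v => ((f + v).choose f : ℝ)) _ _
          (fun v _ => by
            obtain ⟨c, hc, h⟩ := hterm f hf x hx v
            exact ⟨c, hc, fun t ht => h t.1 ht.1 t.2.1 ht.2.1 t.2.2.1 t.2.2.2.1 t.2.2.2.2
              ht.2.2.1 ht.2.2.2.1 ht.2.2.2.2.1 ht.2.2.2.2.2.1 ht.2.2.2.2.2.2⟩)))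
    obtain ⟨c, hc, h⟩ := h1
    refine ⟨c, hc, fun N hN col hcol F i j hF hi hib hj hjb => ?_⟩
    have := h ⟨N, col, F, i, j⟩ ⟨hN, hcol, hF, hi, hib, hj, hjb⟩
    simpa only [one_mul, branchLimit] using this
  obtain ⟨c₁, hc₁, h₁⟩ := hsum
  obtain ⟨c₂, hc₂, h₂⟩ := abs_expect_excursion_sub_branch_le p X l (r + 1)
  refine ⟨c₂ + (p * c₁ + p * |branchLimit p α X b l r| * (K + 1)), by positivity, ?_⟩
  intro N hN col hcol F i hF hi hib
  have hNpos : (0 : ℝ) < N := by exact_mod_cast hN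
  rw [rootedMoment_succ hα b l r hlr, add_mul]
  refine (abs_sub_le _ _ _).trans (add_le_add (h₂ N hN col F i) ?_)
  -- the neighbours `j` of `i`
  set J := Finset.univ.filter fun j => col j = (!b) ∧ j ∉ F with hJ
  have hexp : expect p X N (PowerSeries.coeff l ((∑ j, branchSeries col F i j) ^ (r + 1))) =
      ∑ j ∈ J, p / N * ∑ f ∈ Finset.range (r + 1), (r.choose f : ℝ) *
        ∑ x ∈ Finset.HasAntidiagonal.antidiagonal (l - (f + 1)), ∑ v ∈ Finset.range (x.1 + 1),
          ((f + v).choose f : ℝ) * (X (2 * (f + 1)) * expect p X N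
            (PowerSeries.coeff x.1 (excursionSeries col (insert i F) j ^ v) *
              PowerSeries.coeff x.2 (otherBranches col F i j ^ (r - f)))) := by
    rw [coeff_sum_branchSeries_pow col F i l r hlr, map_sum, hJ, Finset.sum_filter]
    refine Finset.sum_congr rfl fun j _ => ?_
    have hadj : offAdj col F i j ↔ (col j = (!b) ∧ j ∉ F) := by
      unfold offAdj
      rw [hib]
      constructor
      · rintro ⟨_, h2, h3⟩
        refine ⟨?_, h2⟩
        revert h3
        cases b <;> cases col j <;> simp
      · rintro ⟨h1, h2⟩
        refine ⟨hi, h2, ?_⟩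
        rw [h1]
        cases b <;> simp
    split_ifs with hj
    · rw [map_sum, Finset.mul_sum]
      refine Finset.sum_congr rfl fun f _ => ?_
      rw [← nsmul_eq_mul, map_nsmul, nsmul_eq_mul, map_sum, mul_left_comm]
      congr 1
      rw [Finset.mul_sum]
      refine Finset.sum_congr rfl fun x _ => ?_
      rw [map_sum, Finset.mul_sum]
      refine Finset.sum_congr rfl fun v _ => ?_
      rw [← nsmul_eq_mul, map_nsmul, nsmul_eq_mul, offMatrix, walkMatrix_of_adj (hadj.2 hj),
        expect_X_pow_mul (by omega)
          (Subsemiring.mul_mem _ (coeff_excursionSeries_pow_mem col F i j v x.1)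
            (coeff_otherBranches_pow_mem col F i j (r - f) x.2))]
      ring
    · rw [offMatrix, walkMatrix_of_not_adj fun h => hj (hadj.1 h)]
      simp
  rw [hexp, ← Finset.mul_sum]
  set Tj : Fin N → ℝ := fun j => ∑ f ∈ Finset.range (r + 1), (r.choose f : ℝ) *
        ∑ x ∈ Finset.HasAntidiagonal.antidiagonal (l - (f + 1)), ∑ v ∈ Finset.range (x.1 + 1),
          ((f + v).choose f : ℝ) * (X (2 * (f + 1)) * expect p X N
            (PowerSeries.coeff x.1 (excursionSeries col (insert i F) j ^ v) *
              PowerSeries.coeff x.2 (otherBranches col F i j ^ (r - f)))) with hTj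
  set L := branchLimit p α X b l r with hL
  have hT : ∀ j ∈ J, |Tj j - L| ≤ c₁ * (N : ℝ)⁻¹ := by
    intro j hj
    rw [hJ, Finset.mem_filter] at hj
    exact h₁ N hN col hcol F i j hF hi hib hj.2.2 hj.2.1
  have hJN : (J.card : ℝ) * (N : ℝ)⁻¹ ≤ 1 := by
    rw [← div_eq_mul_inv, div_le_one hNpos]
    exact_mod_cast (Finset.card_le_univ J).trans (by simp)
  have hJcard : |(J.card : ℝ) * (N : ℝ)⁻¹ - part α (!b)| ≤ (K + 1) * (N : ℝ)⁻¹ := by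
    have h3 := hcol (!b)
    set J' := Finset.univ.filter fun j => col j = (!b) with hJ'
    have e1 : J = J' \ F := by
      ext j
      simp [hJ, hJ']
    have h4 : J.card ≤ J'.card := Finset.card_le_card (e1 ▸ Finset.sdiff_subset)
    have h5 : J'.card ≤ J.card + K := by
      have := Finset.le_card_sdiff F J'
      rw [← e1] at this
      omega
    have h4' : (J.card : ℝ) ≤ J'.card := by exact_mod_cast h4
    have h5' : (J'.card : ℝ) ≤ J.card + K := by exact_mod_cast h5
    have hNi : (0 : ℝ) ≤ (N : ℝ)⁻¹ := by positivity
    rw [abs_le] at h3 ⊢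
    constructor <;> nlinarith [h3.1, h3.2]
  have hfin : p / N * ∑ j ∈ J, Tj j - p * (part α (!b) * L) =
      p * ((N : ℝ)⁻¹ * ∑ j ∈ J, (Tj j - L)) +
        p * L * ((J.card : ℝ) * (N : ℝ)⁻¹ - part α (!b)) := by
    rw [Finset.sum_sub_distrib, Finset.sum_const, nsmul_eq_mul]
    ring
  rw [hfin]
  have h6 : |∑ j ∈ J, (Tj j - L)| ≤ J.card * (c₁ * (N : ℝ)⁻¹) := by
    refine (Finset.abs_sum_le_sum_abs _ _).trans ((Finset.sum_le_sum hT).trans (le_of_eq ?_))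
    rw [Finset.sum_const, nsmul_eq_mul]
  have h7 : |p * ((N : ℝ)⁻¹ * ∑ j ∈ J, (Tj j - L))| ≤ p * c₁ * (N : ℝ)⁻¹ := by
    rw [abs_mul, abs_mul, abs_of_nonneg hp, abs_of_nonneg (a := (N : ℝ)⁻¹) (by positivity)]
    calc _ ≤ p * ((N : ℝ)⁻¹ * (J.card * (c₁ * (N : ℝ)⁻¹))) := by gcongr
      _ = p * c₁ * (N : ℝ)⁻¹ * ((J.card : ℝ) * (N : ℝ)⁻¹) := by ring
      _ ≤ p * c₁ * (N : ℝ)⁻¹ * 1 := by gcongr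
      _ = _ := mul_one _
  have h8 : |p * L * ((J.card : ℝ) * (N : ℝ)⁻¹ - part α (!b))| ≤
      p * |L| * (K + 1) * (N : ℝ)⁻¹ := by
    rw [abs_mul, abs_mul, abs_of_nonneg hp, mul_assoc (p * |L|)]
    gcongr
  refine (abs_add_le _ _).trans ((add_le_add h7 h8).trans (le_of_eq ?_))
  ring

/-- The expected even spectral moments converge, with rate `1 / N`, to `limitMoment`. -/
theorem abs_expect_trace_sub_le (hp : 0 ≤ p) (hα : α ∈ Set.Ioo (0 : ℝ) 1) (k : ℕ) :
    ∃ c : ℝ, 0 ≤ c ∧ ∀ (N : ℕ), 1 ≤ N → ∀ (col : Fin N → Bool), IsBalanced α col →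
    |(N : ℝ)⁻¹ * expect p X N (∑ i, (offMatrix col ∅ ^ (2 * k)) i i) - limitMoment p α X k| ≤
      c * (N : ℝ)⁻¹ := by
  choose c hc h using fun b v => abs_expect_excursion_sub_le (X := X) hp hα k v 0 b
  set c₁ : ℝ := ∑ v ∈ Finset.range (k + 1), (c true v + c false v) with hc₁
  have hc₁0 : 0 ≤ c₁ := Finset.sum_nonneg fun v _ => add_nonneg (hc _ _) (hc _ _)
  set s : Bool → ℝ := fun b => ∑ v ∈ Finset.range (k + 1), rootedMoment p α X b k v with hs
  refine ⟨c₁ + |s true| + |s false|, by positivity, fun N hN col hcol => ?_⟩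
  have hNpos : (0 : ℝ) < N := by exact_mod_cast hN
  have hlim : limitMoment p α X k = part α true * s true + part α false * s false := by
    rw [limitMoment, hs, Finset.sum_add_distrib]
    simp only [Finset.mul_sum, part_mul_rootedMoment hα, S₁, S₂]
  have hvert : ∀ i, |expect p X N ((offMatrix col ∅ ^ (2 * k)) i i) - s (col i)| ≤
      c₁ * (N : ℝ)⁻¹ := by
    intro i
    have h1 := coeff_pow_succ_eq_sum_choose (X_dvd_excursionSeries col ∅ i)
      (closedSeries_eq col ∅ i) 0 k
    rw [zero_add, pow_one, closedSeries, PowerSeries.coeff_mk] at h1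
    rw [h1, map_sum, hs, hc₁, ← Finset.sum_sub_distrib, Finset.sum_mul]
    refine (Finset.abs_sum_le_sum_abs _ _).trans (Finset.sum_le_sum fun v _ => ?_)
    rw [Nat.choose_zero_right, Nat.cast_one, one_mul]
    refine (h (col i) v N hN col hcol ∅ i (by simp) (by simp) rfl).trans ?_
    have a1 := hc true v
    have a2 := hc false v
    gcongr
    cases col i <;> linarith
  have hsplit : ∑ i, s (col i) =
      ((Finset.univ.filter fun i => col i = true).card : ℝ) * s true +
      ((Finset.univ.filter fun i => col i = false).card : ℝ) * s false := by
    have e1 : ∀ i, s (col i) = (if col i = true then s true else 0) +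
        (if col i = false then s false else 0) := by
      intro i
      cases col i <;> simp
    simp only [e1, Finset.sum_add_distrib, ← Finset.sum_filter, Finset.sum_const, nsmul_eq_mul]
  have e2 : (N : ℝ)⁻¹ * expect p X N (∑ i, (offMatrix col ∅ ^ (2 * k)) i i) -
      limitMoment p α X k =
      (N : ℝ)⁻¹ * ∑ i, (expect p X N ((offMatrix col ∅ ^ (2 * k)) i i) - s (col i)) +
      ((((Finset.univ.filter fun i => col i = true).card : ℝ) * (N : ℝ)⁻¹ - part α true) *
        s true + (((Finset.univ.filter fun i => col i = false).card : ℝ) * (N : ℝ)⁻¹ -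
        part α false) * s false) := by
    rw [Finset.sum_sub_distrib, hsplit, hlim, map_sum]
    ring
  have h3 : |(N : ℝ)⁻¹ * ∑ i, (expect p X N ((offMatrix col ∅ ^ (2 * k)) i i) - s (col i))| ≤
      c₁ * (N : ℝ)⁻¹ := by
    rw [abs_mul, abs_of_nonneg (a := (N : ℝ)⁻¹) (by positivity)]
    have := (Finset.abs_sum_le_sum_abs (fun i => expect p X N ((offMatrix col ∅ ^ (2 * k)) i i) -
      s (col i)) Finset.univ).trans (Finset.sum_le_sum fun i _ => hvert i)
    rw [Finset.sum_const, nsmul_eq_mul, Finset.card_univ, Fintype.card_fin] at this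
    calc _ ≤ (N : ℝ)⁻¹ * ((N : ℝ) * (c₁ * (N : ℝ)⁻¹)) := by gcongr
      _ = _ := by field_simp
  rw [e2]
  refine (abs_add_le _ _).trans ((add_le_add h3 ((abs_add_le _ _).trans (add_le_add
    (b := (N : ℝ)⁻¹ * |s true|) (d := (N : ℝ)⁻¹ * |s false|) ?_ ?_))).trans (le_of_eq (by ring)))
  · rw [abs_mul]
    exact mul_le_mul_of_nonneg_right (hcol true) (abs_nonneg _)
  · rw [abs_mul]
    exact mul_le_mul_of_nonneg_right (hcol false) (abs_nonneg _)

/-- The covariance of two traces is `O(N)`: the `N` diagonal pairs of vertices contribute `O(1)`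
each, the other pairs `O(1 / N)` each. -/
theorem abs_covariance_trace_le (p : ℝ) (X : ℕ → ℝ) (k m : ℕ) :
    ∃ c : ℝ, 0 ≤ c ∧ ∀ (N : ℕ), 1 ≤ N → ∀ (adj : Fin N → Fin N → Prop),
    |expect p X N ((∑ i, (walkMatrix adj ^ k) i i) * ∑ i, (walkMatrix adj ^ m) i i) -
      expect p X N (∑ i, (walkMatrix adj ^ k) i i) *
        expect p X N (∑ i, (walkMatrix adj ^ m) i i)| ≤ c * N := by
  obtain ⟨c, hc, h⟩ := covariance_closedWalk_le p X k m
  obtain ⟨c₁, hc₁, h₁⟩ := abs_expect_closedWalk_le p X k m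
  obtain ⟨c₂, hc₂, h₂⟩ := abs_expect_closedWalk_le p X k 0
  obtain ⟨c₃, hc₃, h₃⟩ := abs_expect_closedWalk_le p X m 0
  refine ⟨c + (c₁ + c₂ * c₃), by positivity, fun N hN adj => ?_⟩
  have hNpos : (0 : ℝ) < N := by exact_mod_cast hN
  have e1 : expect p X N ((∑ i, (walkMatrix adj ^ k) i i) * ∑ i, (walkMatrix adj ^ m) i i) -
      expect p X N (∑ i, (walkMatrix adj ^ k) i i) *
        expect p X N (∑ i, (walkMatrix adj ^ m) i i) =
      ∑ i, ∑ j, (expect p X N ((walkMatrix adj ^ k) i i * (walkMatrix adj ^ m) j j) -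
        expect p X N ((walkMatrix adj ^ k) i i) * expect p X N ((walkMatrix adj ^ m) j j)) := by
    simp only [Finset.sum_mul_sum, map_sum, Finset.sum_sub_distrib]
  have hij : ∀ i j, |expect p X N ((walkMatrix adj ^ k) i i * (walkMatrix adj ^ m) j j) -
      expect p X N ((walkMatrix adj ^ k) i i) * expect p X N ((walkMatrix adj ^ m) j j)| ≤
      c * (N : ℝ)⁻¹ + if j = i then c₁ + c₂ * c₃ else 0 := by
    intro i j
    have hp0 : 0 ≤ c * (N : ℝ)⁻¹ := by positivity
    split_ifs with hji
    · subst hji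
      have a1 := h₁ N hN adj j _ (Dom.refl _)
      have a2 := h₂ N hN adj j ((walkMatrix adj ^ k) j j) (by simpa using Dom.refl _)
      have a3 := h₃ N hN adj j ((walkMatrix adj ^ m) j j) (by simpa using Dom.refl _)
      refine (abs_sub _ _).trans ?_
      rw [abs_mul]
      have := mul_le_mul a2 a3 (abs_nonneg _) hc₂
      linarith
    · rw [add_zero]
      exact h N hN adj i j (fun e => hji e.symm) _ _ (Dom.refl _) (Dom.refl _)
  rw [e1]
  refine (Finset.abs_sum_le_sum_abs _ _).trans ((Finset.sum_le_sum fun i _ =>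
    (Finset.abs_sum_le_sum_abs _ _).trans (Finset.sum_le_sum fun j _ => hij i j)).trans
      (le_of_eq ?_))
  simp only [Finset.sum_add_distrib, Finset.sum_const, nsmul_eq_mul, Finset.card_univ,
    Fintype.card_fin, Finset.sum_ite_eq', Finset.mem_univ, if_true]
  field_simp

end Limit

section Matrices

/-! ### The random matrices -/

section Ensemble

variable {Ω : Type*} [MeasurableSpace Ω] {P : Measure Ω} [IsProbabilityMeasure P]
  {ρ : Measure ℝ} {p : ℝ} {a : Sym2 ℕ → Ω → ℝ} {d : (N : ℕ) → Sym2 (Fin N) → Ω → ℝ}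

theorem IsEnsemble.ae_zero_or_one (h : IsEnsemble P ρ p a d) (hp : 0 < p) {N : ℕ} (hN : p ≤ N)
    (e : Sym2 (Fin N)) : ∀ᵐ ω ∂P, d N e ω = 0 ∨ d N e ω = 1 := by
  have hm := h.measurable_d N hN e
  have hNpos : (0 : ℝ) < N := hp.trans_le hN
  have hd : Disjoint {ω | d N e ω = 0} {ω | d N e ω = 1} := by
    rw [Set.disjoint_left]
    intro ω h0 h1
    simp only [Set.mem_ofPred_eq] at h0 h1
    rw [h0] at h1
    exact zero_ne_one h1
  have h1 : P ({ω | d N e ω = 0} ∪ {ω | d N e ω = 1}) = 1 := by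
    rw [measure_union hd (hm (measurableSet_singleton 1)), h.prob_zero N hN e, h.prob_one N hN e,
      ← ENNReal.ofReal_add]
    · simp
    · rw [sub_nonneg, div_le_one hNpos]; exact hN
    · positivity
  exact (mem_ae_iff_prob_eq_one ((hm (measurableSet_singleton 0)).union
    (hm (measurableSet_singleton 1)))).2 h1

theorem IsEnsemble.ae_pow_eq (h : IsEnsemble P ρ p a d) (hp : 0 < p) {N : ℕ} (hN : p ≤ N)
    (e : Sym2 (Fin N)) {k : ℕ} (hk : k ≠ 0) :
    (fun ω => d N e ω ^ k) =ᵐ[P] {ω | d N e ω = 1}.indicator fun _ => (1 : ℝ) := by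
  filter_upwards [h.ae_zero_or_one hp hN e] with ω hω
  rcases hω with h0 | h1
  · simp [Set.indicator, h0, hk]
  · simp [Set.indicator, h1]

theorem IsEnsemble.integrable_d_pow (h : IsEnsemble P ρ p a d) (hp : 0 < p) {N : ℕ} (hN : p ≤ N)
    (e : Sym2 (Fin N)) (k : ℕ) : Integrable (fun ω => d N e ω ^ k) P := by
  rcases eq_or_ne k 0 with rfl | hk
  · simp
  · refine Integrable.congr ?_ (h.ae_pow_eq hp hN e hk).symm
    exact (integrable_const 1).indicator (h.measurable_d N hN e (measurableSet_singleton 1))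

theorem IsEnsemble.integral_d_pow (h : IsEnsemble P ρ p a d) (hp : 0 < p) {N : ℕ} (hN : p ≤ N)
    (e : Sym2 (Fin N)) {k : ℕ} (hk : k ≠ 0) : ∫ ω, d N e ω ^ k ∂P = p / N := by
  have hS : MeasurableSet {ω | d N e ω = 1} :=
    h.measurable_d N hN e (measurableSet_singleton 1)
  rw [integral_congr_ae (h.ae_pow_eq hp hN e hk), integral_indicator_const _ hS,
    measureReal_def, h.prob_one N hN e, ENNReal.toReal_ofReal (by positivity), smul_eq_mul, mul_one]

/-- The value of an edge polynomial at the entries `a_e d_e`. -/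
def edgeEval (a : Sym2 ℕ → Ω → ℝ) (d : (N : ℕ) → Sym2 (Fin N) → Ω → ℝ) (N : ℕ) (ω : Ω) :
    MvPolynomial (Sym2 (Fin N)) ℕ →+* ℝ :=
  MvPolynomial.eval₂Hom (Nat.castRingHom ℝ)
    fun e => a (e.map Fin.val) ω * d N e ω

/-- By independence, `expect` is the expectation of the edge polynomials. -/
theorem IsEnsemble.integral_edgeEval (h : IsEnsemble P ρ p a d) (hp : 0 < p)
    (hρ : ∀ k : ℕ, Integrable (fun x : ℝ => x ^ k) ρ) {N : ℕ} (hN : p ≤ N)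
    (Q : MvPolynomial (Sym2 (Fin N)) ℕ) :
    Integrable (fun ω => edgeEval a d N ω Q) P ∧
      ∫ ω, edgeEval a d N ω Q ∂P = expect p (weightMoment ρ) N Q := by
  induction Q using MvPolynomial.induction_on' with
  | add Q₁ Q₂ h₁ h₂ =>
    simp only [map_add]
    exact ⟨h₁.1.add h₂.1, by rw [integral_add h₁.1 h₂.1, h₁.2, h₂.2]⟩
  | monomial m c =>
    have hprob : IsProbabilityMeasure ρ := by
      rw [← h.law_a s(0, 0)]
      exact Measure.isProbabilityMeasure_map (h.measurable_a _).aemeasurable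
    -- all the weights and indicators which occur, as one finite independent family
    let Y : Sym2 (Fin N) ⊕ Sym2 (Fin N) → Ω → ℝ :=
      Sum.elim (fun e => a (e.map Fin.val)) (d N)
    let f : Sym2 (Fin N) ⊕ Sym2 (Fin N) → ℝ → ℝ :=
      Sum.elim (fun e x => x ^ m e) (fun e x => x ^ m e)
    have hg : Function.Injective (Sum.map (fun e : Sym2 (Fin N) => e.map Fin.val)
        (id : Sym2 (Fin N) → Sym2 (Fin N))) :=
      (Sym2.map.injective Fin.val_injective).sumMap Function.injective_id
    have hY : iIndepFun Y P := by
      have h1 := (h.indep N hN).precomp hg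
      refine (iIndepFun_congr fun e => ?_).1 h1
      cases e <;> rfl
    have hYm : ∀ e, Measurable (Y e) := by
      rintro (e | e)
      · exact h.measurable_a _
      · exact h.measurable_d N hN e
    have hf : ∀ e, AEStronglyMeasurable (f e) (P.map (Y e)) := by
      rintro (e | e)
      · exact (continuous_pow (m e)).aestronglyMeasurable
      · exact (continuous_pow (m e)).aestronglyMeasurable
    have hfi : ∀ e, Integrable (f e) (P.map (Y e)) := by
      rintro (e | e)
      · change Integrable (fun x => x ^ m e) (P.map (a _))
        rw [h.law_a]
        exact hρ _
      · rw [integrable_map_measure (hf _) (hYm _).aemeasurable]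
        exact h.integrable_d_pow hp hN e (m e)
    have hprod : ∀ ω, edgeEval a d N ω (MvPolynomial.monomial m c) = c * ∏ e, f e (Y e ω) := by
      intro ω
      rw [edgeEval, MvPolynomial.coe_eval₂Hom, MvPolynomial.eval₂_monomial, Fintype.prod_sum_type,
        Finsupp.prod_fintype _ _ (fun _ => pow_zero _), ← Finset.prod_mul_distrib]
      simp only [mul_pow]
      rfl
    simp only [hprod]
    constructor
    · refine Integrable.const_mul ?_ _
      have h1 := Integrable.fintype_prod (μ := fun e => P.map (Y e)) hfi
      rw [← hY.map_fun_eq_pi_map fun e => (hYm e).aemeasurable] at h1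
      exact h1.comp_measurable (measurable_pi_lambda _ hYm)
    · rw [integral_const_mul, hY.integral_fun_prod_comp (fun e => (hYm e).aemeasurable) hf,
        functional_monomial, edgeMoment, Fintype.prod_sum_type, ← Finset.prod_mul_distrib]
      congr 1
      symm
      have hval : ∀ e, (∫ ω, f (Sum.inl e) (Y (Sum.inl e) ω) ∂P) = weightMoment ρ (m e) := by
        intro e
        rw [weightMoment, ← h.law_a (e.map Fin.val),
          integral_map (h.measurable_a _).aemeasurable
            (continuous_pow (m e)).aestronglyMeasurable]
        rfl
      refine (Finset.prod_congr rfl fun e he => ?_).trans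
        (Finset.prod_subset (Finset.subset_univ m.support) fun e _ he => ?_)
      · rw [hval, mul_comm]
        congr 1
        exact (h.integral_d_pow hp hN e (Finsupp.mem_support_iff.1 he)).symm
      · rw [Finsupp.notMem_support_iff] at he
        rw [hval, he, weightMoment]
        change _ * ∫ ω, d N e ω ^ m e ∂P = 1
        simp [he]

end Ensemble

section Spectrum

variable {Ω : Type*} {α : ℝ} {a : Sym2 ℕ → Ω → ℝ} {d : (N : ℕ) → Sym2 (Fin N) → Ω → ℝ}

theorem trace_pow_eq_sum_eigenvalues_pow {n : Type*} [Fintype n] [DecidableEq n]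
    {A : Matrix n n ℝ} (hA : A.IsHermitian) (k : ℕ) :
    (A ^ k).trace = ∑ i, hA.eigenvalues i ^ k := by
  conv_lhs => rw [hA.spectral_theorem]
  rw [← map_pow, Matrix.diagonal_pow, Unitary.conjStarAlgAut_apply, Matrix.trace_mul_cycle]
  simp [Matrix.trace_diagonal]

theorem spectralMoment_eq (N k : ℕ) (ω : Ω) :
    spectralMoment α a d N k ω = (N : ℝ)⁻¹ * (adj α a d N ω ^ k).trace := by
  rw [spectralMoment, spectralMeasure, integral_smul_measure, integral_finsetSum_measure]
  · simp only [integral_dirac]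
    rw [trace_pow_eq_sum_eigenvalues_pow (adj_isHermitian α a d N ω)]
    simp
  · intro j _
    exact integrable_dirac (by simp)

open Classical in
/-- The two colours of the vertices: `true` on the first part. -/
def partColour (α : ℝ) (N : ℕ) (i : Fin N) : Bool := decide (InFirstPart α N i)

theorem adj_eq_map (N : ℕ) (ω : Ω) :
    adj α a d N ω = (edgeEval a d N ω).mapMatrix (offMatrix (partColour α N) ∅) := by
  ext i j
  rw [RingHom.mapMatrix_apply, Matrix.map_apply, adj, Matrix.of_apply]
  have hiff : ((InFirstPart α N i ∧ ¬ InFirstPart α N j) ∨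
      (¬ InFirstPart α N i ∧ InFirstPart α N j)) ↔ offAdj (partColour α N) ∅ i j := by
    simp only [offAdj, partColour, Finset.notMem_empty, not_false_eq_true, true_and, ne_eq,
      decide_eq_decide]
    tauto
  by_cases h : offAdj (partColour α N) ∅ i j
  · rw [if_pos (hiff.2 h), offMatrix, walkMatrix_of_adj h, edgeEval, MvPolynomial.eval₂Hom_X']
    rfl
  · rw [if_neg fun h' => h (hiff.1 h'), offMatrix, walkMatrix_of_not_adj h, map_zero]

/-- The enumerator of all closed walks of length `k`. -/
def tracePoly (α : ℝ) (N k : ℕ) : MvPolynomial (Sym2 (Fin N)) ℕ :=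
  ∑ i, (offMatrix (partColour α N) ∅ ^ k) i i

theorem spectralMoment_eq_edgeEval (N k : ℕ) (ω : Ω) :
    spectralMoment α a d N k ω = (N : ℝ)⁻¹ * edgeEval a d N ω (tracePoly α N k) := by
  rw [spectralMoment_eq, adj_eq_map, ← map_pow, tracePoly, map_sum]
  rfl

theorem spectralMoment_mul_eq (N k m : ℕ) (ω : Ω) :
    spectralMoment α a d N k ω * spectralMoment α a d N m ω =
      (N : ℝ)⁻¹ ^ 2 * edgeEval a d N ω (tracePoly α N k * tracePoly α N m) := by
  rw [spectralMoment_eq_edgeEval, spectralMoment_eq_edgeEval, map_mul]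
  ring

/-- A bipartite graph has no closed walks of odd length. -/
theorem expectedMoment_odd [MeasurableSpace Ω] (P : Measure Ω) (N k : ℕ) :
    expectedMoment P α a d N (2 * k + 1) = 0 := by
  have h0 : tracePoly α N (2 * k + 1) = 0 :=
    Finset.sum_eq_zero fun i _ => offMatrix_pow_odd _ _ _ _
  rw [expectedMoment]
  simp [spectralMoment_eq_edgeEval, h0]

theorem isBalanced_partColour (hα : α ∈ Set.Ioo (0 : ℝ) 1) {N : ℕ} (hN : 1 ≤ N) :
    IsBalanced α (partColour α N) := by
  have hNpos : (0 : ℝ) < N := by exact_mod_cast hN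
  set n := ⌊α * N⌋₊ with hn
  have h0 : 0 ≤ α * N := mul_nonneg hα.1.le hNpos.le
  have hle : (n : ℝ) ≤ α * N := Nat.floor_le h0
  have hlt : α * N < n + 1 := Nat.lt_floor_add_one _
  have hnN : n ≤ N := by
    have : (n : ℝ) ≤ N := hle.trans (by nlinarith [hα.2])
    exact_mod_cast this
  have htrue : (Finset.univ.filter fun i => partColour α N i = true).card = n := by
    have e1 : (Finset.univ.filter fun i => partColour α N i = true) =
        Finset.univ.filter fun i : Fin N => (i : ℕ) < n := by
      ext i
      rw [Finset.mem_filter, Finset.mem_filter]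
      exact and_congr_right fun _ => @decide_eq_true_iff _ (Classical.propDecidable _)
    rw [e1, Fin.card_filter_val_lt]
    omega
  have hsum : (Finset.univ.filter fun i => partColour α N i = true).card +
      (Finset.univ.filter fun i => partColour α N i = false).card = N := by
    have := Finset.card_filter_add_card_filter_not (s := (Finset.univ : Finset (Fin N)))
      (fun i => partColour α N i = true)
    simpa only [Bool.not_eq_true, Finset.card_univ, Fintype.card_fin] using this
  have htrue' : |(n : ℝ) * (N : ℝ)⁻¹ - α| ≤ (N : ℝ)⁻¹ := by
    have e2 : (n : ℝ) * (N : ℝ)⁻¹ - α = (n - α * N) * (N : ℝ)⁻¹ := by field_simp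
    rw [e2, abs_mul, abs_of_nonneg (a := (N : ℝ)⁻¹) (by positivity)]
    refine mul_le_of_le_one_left (by positivity) ?_
    rw [abs_le]
    constructor <;> linarith
  intro b
  cases b
  · have e3 : ((Finset.univ.filter fun i => partColour α N i = false).card : ℝ) = N - n := by
      rw [htrue] at hsum
      rw [eq_sub_iff_add_eq, add_comm]
      exact_mod_cast hsum
    rw [e3, part, if_neg (by simp)]
    have e4 : ((N : ℝ) - n) * (N : ℝ)⁻¹ - (1 - α) = -((n : ℝ) * (N : ℝ)⁻¹ - α) := by
      field_simp
      ring
    rw [e4, abs_neg]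
    exact htrue'
  · rw [htrue, part, if_pos rfl]
    exact htrue'

end Spectrum

section Moments

variable {Ω : Type*} [MeasurableSpace Ω] {P : Measure Ω} [IsProbabilityMeasure P]
  {ρ : Measure ℝ} {p α : ℝ} {a : Sym2 ℕ → Ω → ℝ} {d : (N : ℕ) → Sym2 (Fin N) → Ω → ℝ}

theorem IsEnsemble.expectedMoment_eq (h : IsEnsemble P ρ p a d) (hp : 0 < p)
    (hρ : ∀ k : ℕ, Integrable (fun x : ℝ => x ^ k) ρ) {N : ℕ} (hN : p ≤ N) (k : ℕ) :
    expectedMoment P α a d N k = (N : ℝ)⁻¹ * expect p (weightMoment ρ) N (tracePoly α N k) := by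
  rw [expectedMoment]
  simp only [spectralMoment_eq_edgeEval]
  rw [integral_const_mul, (h.integral_edgeEval hp hρ hN _).2]

theorem IsEnsemble.integrable_spectralMoment (h : IsEnsemble P ρ p a d) (hp : 0 < p)
    (hρ : ∀ k : ℕ, Integrable (fun x : ℝ => x ^ k) ρ) {N : ℕ} (hN : p ≤ N) (k : ℕ) :
    Integrable (spectralMoment α a d N k) P := by
  refine ((h.integral_edgeEval hp hρ hN (tracePoly α N k)).1.const_mul (N : ℝ)⁻¹).congr ?_
  exact Filter.Eventually.of_forall fun ω => (spectralMoment_eq_edgeEval N k ω).symm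

theorem IsEnsemble.integrable_spectralMoment_mul (h : IsEnsemble P ρ p a d) (hp : 0 < p)
    (hρ : ∀ k : ℕ, Integrable (fun x : ℝ => x ^ k) ρ) {N : ℕ} (hN : p ≤ N) (k m : ℕ) :
    Integrable (fun ω => spectralMoment α a d N k ω * spectralMoment α a d N m ω) P := by
  simp only [spectralMoment_mul_eq]
  exact (h.integral_edgeEval hp hρ hN _).1.const_mul _

theorem IsEnsemble.correlator_eq (h : IsEnsemble P ρ p a d) (hp : 0 < p)
    (hρ : ∀ k : ℕ, Integrable (fun x : ℝ => x ^ k) ρ) {N : ℕ} (hN : p ≤ N) (k m : ℕ) :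
    correlator P α a d N k m = (N : ℝ)⁻¹ ^ 2 *
      (expect p (weightMoment ρ) N (tracePoly α N k * tracePoly α N m) -
        expect p (weightMoment ρ) N (tracePoly α N k) *
          expect p (weightMoment ρ) N (tracePoly α N m)) := by
  rw [correlator, h.expectedMoment_eq hp hρ hN, h.expectedMoment_eq hp hρ hN]
  simp only [spectralMoment_mul_eq]
  rw [integral_const_mul, (h.integral_edgeEval hp hρ hN _).2]
  ring

end Moments

end Matrices

end BipartiteSpectrum

end

theorem theorem2
    (ρ : Measure ℝ) [IsProbabilityMeasure ρ]
    (hρ : ∀ k : ℕ, Integrable (fun x : ℝ => x ^ k) ρ)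
    (C : ℝ)
    (hC : ∀ m : ℕ, 1 ≤ m → BipartiteSpectrum.weightMoment ρ (2 * m) ≤ (C * m) ^ (2 * m))
    (p α : ℝ) (hp : 0 < p) (hα : α ∈ Set.Ioo (0 : ℝ) 1) :
    -- the constants `K k m` of (i) depend on `k`, `m`, `p`, `α` and the law `ρ` of the weights only
    (∃ K : ℕ → ℕ → ℝ,
      ∀ {Ω : Type*} [MeasurableSpace Ω] (P : Measure Ω) [IsProbabilityMeasure P]
        (a : Sym2 ℕ → Ω → ℝ) (d : (N : ℕ) → Sym2 (Fin N) → Ω → ℝ),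
        BipartiteSpectrum.IsEnsemble P ρ p a d →
        -- the spectral moments and their products have finite expectations
        (∀ N : ℕ, p ≤ N → ∀ k m : ℕ,
          Integrable (BipartiteSpectrum.spectralMoment α a d N k) P ∧
          Integrable (fun ω => BipartiteSpectrum.spectralMoment α a d N k ω *
            BipartiteSpectrum.spectralMoment α a d N m ω) P) ∧
        -- (i)
        (∀ k m N : ℕ, p ≤ N → |BipartiteSpectrum.correlator P α a d N k m| ≤ K k m / N) ∧
        -- (ii)
        (∀ k : ℕ, Tendsto (fun N : ℕ => BipartiteSpectrum.expectedMoment P α a d N (2 * k)) atTop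
          (𝓝 (BipartiteSpectrum.limitMoment p α (BipartiteSpectrum.weightMoment ρ) k))) ∧
        (∀ k : ℕ, Tendsto (fun N : ℕ => BipartiteSpectrum.expectedMoment P α a d N (2 * k + 1))
          atTop (𝓝 0))) ∧
    -- (iii), with the convention that `1 / 0 = ∞`
    (∀ k : ℕ, 0 ≤ BipartiteSpectrum.limitMoment p α (BipartiteSpectrum.weightMoment ρ) k) ∧
    ∑' k : ℕ, (ENNReal.ofReal (BipartiteSpectrum.limitMoment p α
      (BipartiteSpectrum.weightMoment ρ) (k + 1)) ^ (1 / (2 * ((k : ℝ) + 1))))⁻¹ = ⊤ := by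
  have hX : ∀ k, 0 ≤ BipartiteSpectrum.weightMoment ρ (2 * k) := fun k =>
    integral_nonneg fun x => by
      rw [pow_mul]
      exact pow_nonneg (sq_nonneg x) k
  refine ⟨?_, BipartiteSpectrum.limitMoment_nonneg hp.le hα.1.le hα.2.le hX,
    BipartiteSpectrum.carleman_of_le (by positivity) (BipartiteSpectrum.limitMoment_le hp.le
      hα.1.le hα.2.le hX (by positivity) (BipartiteSpectrum.moment_le_factorial hC))⟩
  choose K _ hK using BipartiteSpectrum.abs_covariance_trace_le p (BipartiteSpectrum.weightMoment ρ)
  have hN1 : ∀ N : ℕ, p ≤ N → 1 ≤ N := fun N hN => by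
    have : (0 : ℝ) < N := hp.trans_le hN
    exact_mod_cast this
  refine ⟨K, fun P _ a d h => ⟨fun N hN k m => ⟨h.integrable_spectralMoment hp hρ hN k,
    h.integrable_spectralMoment_mul hp hρ hN k m⟩, fun k m N hN => ?_, fun k => ?_, fun k => ?_⟩⟩
  · have hNpos : (0 : ℝ) < N := hp.trans_le hN
    rw [h.correlator_eq hp hρ hN, abs_mul, abs_of_nonneg (by positivity)]
    calc _ ≤ (N : ℝ)⁻¹ ^ 2 * (K k m * N) :=
          mul_le_mul_of_nonneg_left (hK k m N (hN1 N hN) _) (by positivity)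
      _ = K k m / N := by field_simp
  · obtain ⟨c, _, hc⟩ := BipartiteSpectrum.abs_expect_trace_sub_le
      (X := BipartiteSpectrum.weightMoment ρ) hp.le hα k
    rw [tendsto_iff_norm_sub_tendsto_zero]
    have hlim : Tendsto (fun N : ℕ => c * (N : ℝ)⁻¹) atTop (𝓝 0) := by
      simpa using tendsto_inv_atTop_nhds_zero_nat.const_mul c
    refine squeeze_zero' (Eventually.of_forall fun N => norm_nonneg _) ?_ hlim
    filter_upwards [eventually_ge_atTop ⌈p⌉₊] with N hN
    have hpN : p ≤ N := Nat.ceil_le.1 hN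
    rw [h.expectedMoment_eq hp hρ hpN]
    exact hc N (hN1 N hpN) _ (BipartiteSpectrum.isBalanced_partColour hα (hN1 N hpN))
  · simp only [BipartiteSpectrum.expectedMoment_odd]
    exact tendsto_const_nhds
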